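/- Let $q>2$ be a prime power and let $F_q\subset F_{q^2}$ be the finite fields with $q$ and $q^2$ elements. For a set $\mathcal U$ of points of $PG(2,q^2)$ let $\Gamma_{\mathcal U}$ be the graph whose vertices are the points of $PG(2,q^2)\setminus\mathcal U$, two distinct points being adjacent if the line joining them is tangent to $\mathcal U$, i.e. contains exactly one point of $\mathcal U$. Let $H(2,q^2)$ be the Hermitian curve $X_0^{q+1}+X_1^{q+1}+X_2^{q+1}=0$ and put $NU(3,q^2)=\Gamma_{H(2,q^2)}$. A Buekenhout unital of $PG(2,q^2)$ is a set of points that is projectively equivalent to one of the following: (a) (orthogonal Buekenhout--Metz unital) $\{(x,\alpha x^2+\beta x^{q+1}+z,1) : x\in F_{q^2},\ z\in F_q\}\cup\{(0,1,0)\}$, where $\alpha,\beta\in F_{q^2}$ are such that $(\beta-\beta^q)^2+4\alpha^{q+1}$ is a non-square in $F_q$ if $q$ is odd, and $\beta\notin F_q$ and $\alpha^{q+1}/(\beta+\beta^q)^2$ has absolute trace $0$ if $q$ is even; (b) (Buekenhout--Tits unital) for $q=2^m$ with $m>1$ odd and $\delta=2^{(m+1)/2}$, $\{(x_0+x_1\beta,(x_0^{\delta+2}+x_0x_1+x_1^{\delta})\beta+z,1)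 : x_0,x_1,z\in F_q\}\cup\{(0,1,0)\}$, where $\beta\in F_{q^2}\setminus F_q$. It is called classical if it is projectively equivalent to $H(2,q^2)$. Theorem. If $\mathcal U$ is a non-classical Buekenhout unital of $PG(2,q^2)$, then $\Gamma_{\mathcal U}$ and $NU(3,q^2)$ are both strongly regular with parameters $$\bigl(q^2(q^2-q+1),\ (q+1)(q^2-1),\ 2(q^2-1),\ (q+1)^2\bigr),$$ but $\Gamma_{\mathcal U}$ is not isomorphic to $NU(3,q^2)$. -/

import Mathlib

noncomputable section

namespace TangentGraph

/-- The Desarguesian projective plane over `K`, as the set of its points: the one-dimensional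
subspaces of `K³`. For a field `K` with `q²` elements this is `PG(2,q²)`. -/
abbrev Plane (K : Type*) [Field K] : Type _ := Projectivization K (Fin 3 → K)

/-- The point with homogeneous coordinates `(x, y, 1)`. -/
def affinePoint {K : Type*} [Field K] (x y : K) : Plane K :=
  Projectivization.mk K ![x, y, 1] (fun h => one_ne_zero (congrFun h 2))

/-- The point with homogeneous coordinates `(0, 1, 0)`. -/
def infinitePoint (K : Type*) [Field K] : Plane K :=
  Projectivization.mk K ![0, 1, 0] (fun h => one_ne_zero (congrFun h 1))

/-- The set of points on the line joining the (distinct) points `P` and `Q`. -/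
def lineThrough {K : Type*} [Field K] (P Q : Plane K) : Set (Plane K) :=
  {R | R.submodule ≤ P.submodule ⊔ Q.submodule}

/-- The graph on the points outside `U` in which two distinct points are adjacent if the line
joining them is tangent to `U`, that is, contains exactly one point of `U`. -/
def tangentGraph {K : Type*} [Field K] (U : Set (Plane K)) : SimpleGraph {P : Plane K // P ∉ U} where
  Adj P Q := P ≠ Q ∧ ∃! R : Plane K, R ∈ U ∧ R ∈ lineThrough P.1 Q.1
  symm := ⟨by
    rintro P Q ⟨hne, h⟩
    refine ⟨hne.symm, ?_⟩
    simpa only [lineThrough, sup_comm] using h⟩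
  loopless := ⟨fun _ h => h.1 rfl⟩

/-- Two sets of points are projectively equivalent if an invertible linear map of `K³` induces a
projectivity that takes one to the other. -/
def ProjEquivalent {K : Type*} [Field K] (U V : Set (Plane K)) : Prop :=
  ∃ g : (Fin 3 → K) ≃ₗ[K] (Fin 3 → K), Projectivization.map g.toLinearMap g.injective '' V = U

/-- The Hermitian curve `H(2,q²)`, in its canonical form `X₀^(q+1) + X₁^(q+1) + X₂^(q+1) = 0`. -/
def hermitianCurve (K : Type*) [Field K] (q : ℕ) : Set (Plane K) :=
  {P | ∃ (v : Fin 3 → K) (hv : v ≠ 0), P = Projectivization.mk K v hv ∧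
    v 0 ^ (q + 1) + v 1 ^ (q + 1) + v 2 ^ (q + 1) = 0}

/-- The graph `NU(3,q²)`. -/
abbrev NU3 (K : Type*) [Field K] (q : ℕ) : SimpleGraph {P : Plane K // P ∉ hermitianCurve K q} :=
  tangentGraph (hermitianCurve K q)

/-- A classical unital: a set of points projectively equivalent to the Hermitian curve. -/
def IsClassical {K : Type*} [Field K] (q : ℕ) (U : Set (Plane K)) : Prop :=
  ProjEquivalent U (hermitianCurve K q)

section Buekenhout

variable (F : Type*) {K : Type*} [Field F] [Field K] [Algebra F K]

/-- The point set `{(x, α x² + β x^(q+1) + z, 1) : x ∈ K, z ∈ F} ∪ {(0,1,0)}`, `q = |F|`. -/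
def bmSet (α β : K) : Set (Plane K) :=
  {P | ∃ (x : K) (z : F),
      P = affinePoint x (α * x ^ 2 + β * x ^ (Nat.card F + 1) + algebraMap F K z)} ∪
    {infinitePoint K}

/-- The absolute trace of an element `c` of a finite field with `2^h` elements,
`c + c² + c⁴ + ⋯ + c^(2^(h-1))`. -/
def absTrace₂ {F : Type*} [Field F] (c : F) : F :=
  ∑ i ∈ Finset.range (Nat.log 2 (Nat.card F)), c ^ 2 ^ i

/-- The condition on `(α, β)` under which `bmSet F α β` is an orthogonal Buekenhout-Metz unital,
for `q = |F| > 2` odd and even respectively. -/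
def BMCondition (α β : K) : Prop :=
  (Odd (Nat.card F) ∧ ∃ d : F, ¬ IsSquare d ∧
      algebraMap F K d = (β - β ^ Nat.card F) ^ 2 + 4 * α ^ (Nat.card F + 1)) ∨
  (Even (Nat.card F) ∧ β ∉ Set.range (algebraMap F K) ∧ ∃ c : F, absTrace₂ c = 0 ∧
      algebraMap F K c = α ^ (Nat.card F + 1) / (β + β ^ Nat.card F) ^ 2)

/-- Orthogonal Buekenhout-Metz unitals of `PG(2,q²)`, where `q = |F| > 2`. -/
def IsOrthogonalBuekenhoutMetz (U : Set (Plane K)) : Prop :=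
  2 < Nat.card F ∧ ∃ α β : K, BMCondition F α β ∧ ProjEquivalent U (bmSet F α β)

/-- The point set `{(x₀ + x₁ β, (x₀^(δ+2) + x₀ x₁ + x₁^δ) β + z, 1) : x₀, x₁, z ∈ F} ∪ {(0,1,0)}`. -/
def btSet (δ : ℕ) (β : K) : Set (Plane K) :=
  {P | ∃ x₀ x₁ z : F,
      P = affinePoint (algebraMap F K x₀ + algebraMap F K x₁ * β)
        (algebraMap F K (x₀ ^ (δ + 2) + x₀ * x₁ + x₁ ^ δ) * β + algebraMap F K z)} ∪
    {infinitePoint K}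

/-- Buekenhout-Tits unitals of `PG(2,q²)`, where `q = |F| = 2^m` with `m > 1` odd. -/
def IsBuekenhoutTits (U : Set (Plane K)) : Prop :=
  ∃ m : ℕ, 1 < m ∧ Odd m ∧ Nat.card F = 2 ^ m ∧
    ∃ β : K, β ∉ Set.range (algebraMap F K) ∧
      ProjEquivalent U (btSet F (2 ^ ((m + 1) / 2)) β)

/-- Buekenhout unitals of `PG(2,q²)`, `q = |F|`. -/
def IsBuekenhout (U : Set (Plane K)) : Prop :=
  IsOrthogonalBuekenhoutMetz F U ∨ IsBuekenhoutTits F U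

end Buekenhout

open scoped Classical in
/-- Strong regularity with parameters `(n, k, ℓ, μ)` of a graph on a finite vertex set. -/
def IsSRG {V : Type*} [Finite V] (G : SimpleGraph V) (n k ℓ μ : ℕ) : Prop :=
  letI : Fintype V := Fintype.ofFinite V
  G.IsSRGWith n k ℓ μ

end TangentGraph

end

/-! Write `q = |F|` and `N(x) = x * conj F x`. Up to projectivity every Buekenhout unital is `{(x,
y, 1) : τ y = φ x} ∪ {(0, 1, 0)}`, where `τ : K → F` is `F`-linear with kernel `F`. Its affine part
is governed by a dual function `G`: the line `y = m x + b` is tangent if and only if `τ b = G m`,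
and otherwise meets the set in `q + 1` points (`OvoidData`). Hence the set is a unital.

A point of a unital lies on one tangent and a point off it on `q + 1` tangents, so two tangents
always meet in a point off the unital. The tangents, as points, and the points off the unital, as
blocks, thus form a design with block size `q + 1` and `q ^ 2` blocks on each point
(`IsUnital.isDesign`). The tangent graph is the block graph of this design, which yields strong
regularity with parameters depending only on `q`.

To separate the two graphs, count the ordered adjacent pairs among the common neighbours of two
adjacent vertices. In the block graph of a design this is a constant determined by the parameters,
plus the number of ordered ways to complete the two blocks to a quadrangle: four blocks that meet
pairwise, no three in one point (`IsDesign.cliqueCount_eq`). So a design with a quadrangle and one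
without, of the same parameters, have non-isomorphic block graphs.

The Hermitian curve has no quadrangle. Tangency of the line joining two points off the curve means
that their Gram determinant vanishes; normalising the Gram matrix of four such points then forces a
dependent triple (`false_of_gram`). Conversely, if an ovoidal unital has no quadrangle containing
`(1, 0, 0)`, then `G` is a multiple of the norm (`OvoidData.eq_norm_of_forall_not_isQuadrangle`).
For an orthogonal Buekenhout-Metz unital this forces `α = 0`, which is the classical case
(`bm_eq_zero_of_dual_eq_norm`), and for a Buekenhout-Tits unital it never happens
(`tits_ovoidData`). -/

namespace TangentGraph

/-! ### Quadratic extensions of finite fields: conjugation, coordinates, fibre sizes. -/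

section Fields

variable {F K : Type*} [Field F] [Field K] [Finite F] [Finite K] [Algebra F K]

variable (F) in
/-- The Frobenius map `w ↦ w ^ |F|` of an extension `K` of the finite field `F`. -/
noncomputable def conj : K →ₐ[F] K :=
  letI := Fintype.ofFinite F
  FiniteField.frobeniusAlgHom F K

theorem conj_apply (w : K) : conj F w = w ^ Nat.card F := by
  let := Fintype.ofFinite F
  rw [Nat.card_eq_fintype_card]
  rfl

theorem pow_card_add_one (w : K) : w ^ (Nat.card F + 1) = w * conj F w := by
  rw [conj_apply, pow_succ']

theorem natCard_eq_sq (hFK : Module.finrank F K = 2) : Nat.card K = Nat.card F ^ 2 := by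
  rw [Module.natCard_eq_pow_finrank (K := F) (V := K), hFK]

theorem conj_conj (hFK : Module.finrank F K = 2) (w : K) : conj F (conj F w) = w := by
  have := Fintype.ofFinite K
  rw [conj_apply, conj_apply, ← pow_mul, ← sq, ← natCard_eq_sq hFK, Nat.card_eq_fintype_card,
    FiniteField.pow_card]

theorem conj_eq_self_iff {w : K} : conj F w = w ↔ w ∈ Set.range (algebraMap F K) := by
  have := Fintype.ofFinite F
  classical
  constructor
  · intro h
    obtain ⟨p, hp⟩ : ∃ p : Polynomial K, p = Polynomial.X ^ Fintype.card F - Polynomial.X := ⟨_, rfl⟩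
    have hp0 : p ≠ 0 := hp ▸ FiniteField.X_pow_card_sub_X_ne_zero K Fintype.one_lt_card
    have hsub : Finset.univ.image (algebraMap F K) ⊆ p.roots.toFinset := by
      intro x hx
      obtain ⟨y, -, rfl⟩ := Finset.mem_image.1 hx
      rw [Multiset.mem_toFinset, Polynomial.mem_roots hp0, hp]
      simp [← map_pow, FiniteField.pow_card]
    have hcard : p.roots.toFinset.card ≤ (Finset.univ.image (algebraMap F K)).card := by
      rw [Finset.card_image_of_injective _ (algebraMap F K).injective, Finset.card_univ]
      refine (Multiset.toFinset_card_le _).trans ((Polynomial.card_roots' p).trans ?_)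
      rw [hp, FiniteField.X_pow_card_sub_X_natDegree_eq K Fintype.one_lt_card]
    have hw : w ∈ p.roots.toFinset := by
      rw [conj_apply, Nat.card_eq_fintype_card] at h
      rw [Multiset.mem_toFinset, Polynomial.mem_roots hp0, hp]
      simp [h]
    rw [← Finset.eq_of_subset_of_card_le hsub hcard] at hw
    obtain ⟨y, -, rfl⟩ := Finset.mem_image.1 hw
    exact ⟨y, rfl⟩
  · rintro ⟨y, rfl⟩
    exact AlgHom.commutes _ _

theorem conj_eq_zero {w : K} : conj F w = 0 ↔ w = 0 := map_eq_zero _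

theorem exists_mul_conj (hFK : Module.finrank F K = 2) (w : K) :
    ∃ f : F, algebraMap F K f = w * conj F w := by
  obtain ⟨f, hf⟩ := conj_eq_self_iff.1 (show conj F (w * conj F w) = w * conj F w by
    rw [map_mul, conj_conj hFK, mul_comm])
  exact ⟨f, hf⟩

/-- An `F`-linear functional on `K` whose kernel is `F`. -/
def IsCoord (τ : K →ₗ[F] F) : Prop := ∀ w, τ w = 0 ↔ w ∈ Set.range (algebraMap F K)

theorem exists_coord (hFK : Module.finrank F K = 2) {β : K} (hβ : β ∉ Set.range (algebraMap F K)) :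
    ∃ τ : K →ₗ[F] F, IsCoord τ ∧ τ β = 1 ∧
      ∀ w, ∃ x : F, w = algebraMap F K x + algebraMap F K (τ w) * β := by
  have hli : LinearIndependent F ![(1 : K), β] := by
    rw [LinearIndependent.pair_iff' one_ne_zero]
    intro a h
    exact hβ ⟨a, by rw [← h, Algebra.smul_def, mul_one]⟩
  let b := basisOfLinearIndependentOfCardEqFinrank hli (by simp [hFK])
  have hb0 : b 0 = 1 := by simp [b]
  have hb1 : b 1 = β := by simp [b]
  have hrep : ∀ w, w = algebraMap F K (b.repr w 0) + algebraMap F K (b.repr w 1) * β := by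
    intro w
    conv_lhs => rw [← b.sum_repr w]
    simp [Fin.sum_univ_two, hb0, hb1, Algebra.smul_def]
  refine ⟨b.coord 1, ?_, ?_, fun w => ⟨b.repr w 0, hrep w⟩⟩
  · intro w
    rw [Module.Basis.coord_apply]
    constructor
    · intro h
      refine ⟨b.repr w 0, ?_⟩
      conv_rhs => rw [hrep w, h]
      simp
    · rintro ⟨y, rfl⟩
      have : algebraMap F K y = y • b 0 := by rw [hb0, Algebra.smul_def, mul_one]
      rw [this]
      simp
  · rw [Module.Basis.coord_apply, ← hb1]
    simp

theorem IsCoord.map_conj {τ : K →ₗ[F] F} (hτ : IsCoord τ) (hFK : Module.finrank F K = 2) (w : K) :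
    τ (conj F w) = -τ w := by
  rw [eq_neg_iff_add_eq_zero, ← map_add, hτ, ← conj_eq_self_iff, map_add, conj_conj hFK, add_comm]

theorem IsCoord.map_algebraMap {τ : K →ₗ[F] F} (hτ : IsCoord τ) (x : F) :
    τ (algebraMap F K x) = 0 := (hτ _).2 ⟨x, rfl⟩

theorem map_algebraMap_mul (τ : K →ₗ[F] F) (x : F) (w : K) :
    τ (algebraMap F K x * w) = x * τ w := by
  rw [← Algebra.smul_def, map_smul, smul_eq_mul]

theorem IsCoord.mul_sub_conj {τ : K →ₗ[F] F} (hτ : IsCoord τ) {β : K} (hβ : τ β = 1)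
    (w : K) : algebraMap F K (τ w) * (β - conj F β) = w - conj F w := by
  obtain ⟨x, hx⟩ := (hτ (w - algebraMap F K (τ w) * β)).1 (by
    rw [map_sub, map_algebraMap_mul, hβ, mul_one, sub_self])
  have hw : w = algebraMap F K x + algebraMap F K (τ w) * β := by rw [hx]; ring
  conv_rhs => rw [hw]
  simp only [map_add, map_mul, AlgHom.commutes]
  ring

/-- A function that vanishes only at `0`, and whose nonzero fibres are not too large, has all
its nonzero fibres of the same size `|F| + 1`. -/
theorem ncard_fiber (hFK : Module.finrank F K = 2) (φ : K → F) (h0 : ∀ x, φ x = 0 ↔ x = 0)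
    (h : ∀ c ≠ 0, ∃ e : {x // φ x = c} × Fˣ → K, Function.Injective e ∧ ∀ p, e p ≠ 0)
    (c : F) (hc : c ≠ 0) : {x | φ x = c}.ncard = Nat.card F + 1 := by
  classical
  have := Fintype.ofFinite F
  have := Fintype.ofFinite K
  have hq : 1 < Fintype.card F := Fintype.one_lt_card
  have hK : Fintype.card K = Fintype.card F ^ 2 := by
    rw [← Nat.card_eq_fintype_card, natCard_eq_sq hFK, Nat.card_eq_fintype_card]
  let f : F → ℕ := fun c => (Finset.univ.filter fun x => φ x = c).card
  -- Fibre times `Fˣ` embeds in the nonzero elements of `K`, so a fibre has at most `(q² - 1) / (q -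
  -- 1) = q + 1` elements.
  have hle : ∀ c ≠ 0, f c ≤ Fintype.card F + 1 := by
    intro c hc
    obtain ⟨e, he, he0⟩ := h c hc
    have h1 := Fintype.card_le_of_injective (fun p => Units.mk0 (e p) (he0 p)) (by
      intro p p' hp
      exact he (by simpa [Units.ext_iff] using hp))
    rw [Fintype.card_prod, Fintype.card_units, Fintype.card_units, Fintype.card_subtype, hK] at h1
    have h2 : Fintype.card F ^ 2 - 1 = (Fintype.card F + 1) * (Fintype.card F - 1) := by
      simpa using Nat.sq_sub_sq (Fintype.card F) 1
    rw [h2] at h1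
    exact Nat.le_of_mul_le_mul_right h1 (by omega)
  have hsum : ∑ c, f c = Fintype.card F ^ 2 := by
    rw [← hK, ← Finset.card_univ]
    exact (Finset.card_eq_sum_card_fiberwise (fun x _ => Finset.mem_univ (φ x))).symm
  have hf0 : f 0 = 1 := by
    simp only [f, h0]
    rw [Finset.card_eq_one]
    exact ⟨0, by ext; simp⟩
  -- The `q - 1` nonzero fibres share `q² - 1` elements, so none can fall short of the bound.
  have hfc : f c = Fintype.card F + 1 := by
    refine le_antisymm (hle c hc) ?_
    have h1 := Finset.add_sum_erase Finset.univ f (Finset.mem_univ (0 : F))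
    have hmem : c ∈ (Finset.univ : Finset F).erase 0 := by simp [hc]
    have h2 := Finset.add_sum_erase _ f hmem
    have h3 : ∑ x ∈ (Finset.univ.erase (0 : F)).erase c, f x ≤
        (Fintype.card F - 1 - 1) * (Fintype.card F + 1) := by
      refine (Finset.sum_le_card_nsmul _ _ (Fintype.card F + 1) ?_).trans ?_
      · intro x hx
        exact hle x (by simp at hx; exact hx.2)
      · rw [smul_eq_mul, Finset.card_erase_of_mem hmem,
          Finset.card_erase_of_mem (Finset.mem_univ _), Finset.card_univ]
    rw [hsum, hf0] at h1
    obtain ⟨n, hn⟩ : ∃ n, Fintype.card F = n + 2 := ⟨Fintype.card F - 2, by omega⟩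
    rw [hn] at h1 h3 ⊢
    have : n + 2 - 1 - 1 = n := by omega
    rw [this] at h3
    nlinarith
  rw [Set.ncard_eq_toFinset_card', Nat.card_eq_fintype_card, ← hfc]
  congr 1
  ext
  simp

end Fields

/-! ### Dual functions; the quadratic case and the norm. -/

section Ovoid

variable {F K : Type*} [Field F] [Field K] [Finite F] [Finite K] [Algebra F K]

/-- The data of an ovoidal Buekenhout-Metz unital `{(x, y, 1) : τ y = φ x} ∪ {(0, 1, 0)}`: the line
`y = m x + b` is tangent if `τ b = G m`, and meets it in `|F| + 1` points otherwise. -/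
structure OvoidData (τ : K →ₗ[F] F) (φ G : K → F) : Prop where
  coord : IsCoord τ
  unique : ∀ m, ∃! x, φ x = τ (m * x) + G m
  ncard : ∀ m c, c ≠ G m → {x | φ x = τ (m * x) + c}.ncard = Nat.card F + 1
  zero : ∀ m, G m = 0 ↔ m = 0

/-- The substitution `ψ` absorbs the linear term `τ (m * x)`, so every line section becomes a fibre
of `φ`: the zero fibre for a tangent, a nonzero fibre otherwise. -/
theorem OvoidData.of_bijective {τ : K →ₗ[F] F} {φ G : K → F} (hτ : IsCoord τ)
    (h0 : ∀ x, φ x = 0 ↔ x = 0) (hfib : ∀ c ≠ 0, {x | φ x = c}.ncard = Nat.card F + 1)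
    (hψ : ∀ m, ∃ ψ : K → K, ψ.Bijective ∧ ∀ x, φ (ψ x) = φ x - τ (m * x) - G m)
    (hG : ∀ m, G m = 0 ↔ m = 0) : OvoidData τ φ G where
  coord := hτ
  unique m := by
    obtain ⟨ψ, hb, hψ⟩ := hψ m
    obtain ⟨x, hx, hu⟩ := hb.existsUnique 0
    have key : ∀ y, φ y = τ (m * y) + G m ↔ ψ y = 0 := by
      intro y
      rw [← h0, hψ, sub_sub, sub_eq_zero]
    exact ⟨x, (key x).2 hx, fun y hy => hu y ((key y).1 hy)⟩
  ncard m c hc := by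
    obtain ⟨ψ, hb, hψ⟩ := hψ m
    rw [← hfib (c - G m) (sub_ne_zero.2 hc)]
    have : {x | φ x = c - G m} = ψ '' {x | φ x = τ (m * x) + c} := by
      ext y
      obtain ⟨x, rfl⟩ := hb.2 y
      rw [hb.1.mem_set_image, Set.mem_ofPred_eq, Set.mem_ofPred_eq, hψ]
      constructor <;> intro h <;> linear_combination h
    rw [this, Set.ncard_image_of_injective _ hb.1]
  zero := hG

/-- The discriminant `(β - β^q)² + 4 α^(q+1)` of the quadratic form of `bmSet F α β`. -/
noncomputable def bmDisc (F : Type*) {K : Type*} [Field F] [Field K] [Finite F] [Algebra F K] (α β : K) : K :=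
  (β - conj F β) ^ 2 + 4 * (α * conj F α)

/-- The mixed term contains `β * x * conj F s`. Since `τ` changes sign under conjugation, it may be
traded for `-(conj F β * conj F x * s)`, after which `s` factors out. -/
theorem bm_polar {τ : K →ₗ[F] F} (hτ : IsCoord τ) (hFK : Module.finrank F K = 2) (α β x s : K) :
    τ (α * (x + s) ^ 2 + β * ((x + s) * conj F (x + s))) =
      τ (α * x ^ 2 + β * (x * conj F x)) + τ (α * s ^ 2 + β * (s * conj F s)) +
        τ ((2 * α * x + (β - conj F β) * conj F x) * s) := by
  have h := hτ.map_conj hFK (β * (x * conj F s))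
  rw [map_mul (conj F), map_mul (conj F), conj_conj hFK] at h
  rw [← sub_eq_zero] at h ⊢
  rw [← map_neg, ← map_sub] at h
  rw [← map_add, ← map_add, ← map_sub]
  rw [← h]
  congr 1
  rw [map_add]
  ring

/-- Eliminating between the equation of the kernel and its conjugate leaves `bmDisc F α β * N(x) =
0`; the polar form is therefore nondegenerate. -/
theorem bm_polar_bijective (hFK : Module.finrank F K = 2) {α β : K} (hD : bmDisc F α β ≠ 0) :
    Function.Bijective fun x : K => 2 * α * x + (β - conj F β) * conj F x := by
  rw [← Finite.injective_iff_bijective]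
  have hker : ∀ x : K, 2 * α * x + (β - conj F β) * conj F x = 0 → x = 0 := by
    intro x hx
    have h2 := congrArg (conj F) hx
    simp only [map_add, map_mul, map_sub, conj_conj hFK, map_zero, map_ofNat] at h2
    have h3 : bmDisc F α β * (x * conj F x) = 0 := by
      rw [bmDisc]
      linear_combination (2 * conj F α * conj F x) * hx - (β - conj F β) * conj F x * h2
    rcases mul_eq_zero.1 h3 with h | h
    · exact absurd h hD
    · rcases mul_eq_zero.1 h with h | h
      · exact h
      · exact conj_eq_zero.1 h
  intro x y hxy
  rw [← sub_eq_zero]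
  refine hker _ ?_
  rw [map_sub]
  simp only at hxy
  linear_combination hxy

/-- Here `φ` is an anisotropic quadratic form over `F` with polar form `τ (M x * s)`. Completing the
square at the `x₀` with `M x₀ = m` gives `G m = -φ x₀`. This explicit value is what later allows `G`
to be compared with the norm. -/
theorem bm_ovoidData {τ : K →ₗ[F] F} (hτ : IsCoord τ) (hFK : Module.finrank F K = 2) {α β : K}
    (hD : bmDisc F α β ≠ 0) (h0 : ∀ x, τ (α * x ^ 2 + β * (x * conj F x)) = 0 → x = 0) :
    ∃ G : K → F, OvoidData τ (fun x => τ (α * x ^ 2 + β * (x * conj F x))) G ∧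
      ∀ x, G (2 * α * x + (β - conj F β) * conj F x) =
        -τ (α * x ^ 2 + β * (x * conj F x)) := by
  obtain ⟨φ, hφ⟩ : ∃ φ : K → F, φ = fun x => τ (α * x ^ 2 + β * (x * conj F x)) := ⟨_, rfl⟩
  obtain ⟨M, hM⟩ : ∃ M : K → K, M = fun x => 2 * α * x + (β - conj F β) * conj F x := ⟨_, rfl⟩
  have hMb : M.Bijective := hM ▸ bm_polar_bijective hFK hD
  have hpol : ∀ x s, φ (x + s) = φ x + φ s + τ (M x * s) := by
    intro x s
    simp only [hφ, hM]
    exact bm_polar hτ hFK α β x s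
  have hφ0 : ∀ x, φ x = 0 ↔ x = 0 := by
    refine fun x => ⟨fun h => h0 x (by simpa [hφ] using h), ?_⟩
    rintro rfl
    simp [hφ]
  obtain ⟨N, hN⟩ : ∃ N : K → K, ∀ m, M (N m) = m := ⟨_, Function.surjInv_eq hMb.2⟩
  have hM0 : M 0 = 0 := by simp [hM]
  have hsmul : ∀ (l : F) x, φ (algebraMap F K l * x) = l ^ 2 * φ x := by
    intro l x
    simp only [hφ]
    rw [← map_algebraMap_mul]
    congr 1
    rw [map_mul, map_pow, AlgHom.commutes]
    ring
  -- The direction of a line touching the fibre at `x`; it represents the base point `x₁` below.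
  have hexM : ∀ x, ∃ d : K, d ≠ 0 ∧ τ (M x * d) = 0 := by
    intro x
    by_cases hx : M x = 0
    · exact ⟨1, one_ne_zero, by simp [hx]⟩
    · refine ⟨(M x)⁻¹, inv_ne_zero hx, ?_⟩
      rw [mul_inv_cancel₀ hx, hτ]
      exact ⟨1, map_one _⟩
  have hfib : ∀ c ≠ 0, {x | φ x = c}.ncard = Nat.card F + 1 := by
    refine ncard_fiber hFK φ hφ0 fun c hc => ?_
    by_cases hne : ∃ x₁, φ x₁ = c
    swap
    · refine ⟨fun p => p.1.1, fun p => absurd ⟨_, p.1.2⟩ hne, fun p => absurd ⟨_, p.1.2⟩ hne⟩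
    obtain ⟨x₁, hx₁⟩ := hne
    -- Parametrisation of a conic from one of its points: `R d` is the second intersection of `x₁ +
    -- F d` with the fibre, and depends on `d` only up to a scalar in `F`.
    obtain ⟨R, hR⟩ : ∃ R : K → K,
        R = fun d => x₁ - algebraMap F K (τ (M x₁ * d) / φ d) * d := ⟨_, rfl⟩
    have hRex : ∀ x : {x // φ x = c}, ∃ d, d ≠ 0 ∧ R d = x := by
      rintro ⟨x, hx⟩
      by_cases hxx : x = x₁
      · obtain ⟨d, hd, hd'⟩ := hexM x₁
        exact ⟨d, hd, by simp [hR, hd', hxx]⟩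
      · have hd : x - x₁ ≠ 0 := sub_ne_zero.2 hxx
        refine ⟨x - x₁, hd, ?_⟩
        have h1 := hpol x₁ (x - x₁)
        rw [add_sub_cancel, hx, hx₁] at h1
        have h2 : τ (M x₁ * (x - x₁)) = -φ (x - x₁) := by linear_combination -h1
        have h3 : φ (x - x₁) ≠ 0 := mt (hφ0 _).1 hd
        simp only [hR]
        rw [h2, neg_div, div_self h3]
        simp
    have hRs : ∀ (l : Fˣ) d, R (algebraMap F K l * d) = R d := by
      intro l d
      have hl : (l : F) ≠ 0 := l.ne_zero
      simp only [hR]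
      rw [hsmul, mul_left_comm (M x₁), map_algebraMap_mul, mul_left_comm, ← mul_assoc, ← map_mul]
      congr 3
      field_simp
    choose d hd0 hd using hRex
    refine ⟨fun p => algebraMap F K p.2 * d p.1, ?_, ?_⟩
    · rintro ⟨x, l⟩ ⟨y, n⟩ h
      simp only at h
      have hxy : x = y := by
        have := congrArg R h
        rw [hRs, hRs, hd, hd] at this
        exact Subtype.ext this
      subst hxy
      have h' := (algebraMap F K).injective (mul_right_cancel₀ (hd0 x) h)
      rw [Units.ext h']
    · rintro ⟨x, l⟩
      exact mul_ne_zero (by simp) (hd0 x)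
  refine ⟨fun m => -φ (N m), ?_, ?_⟩
  · rw [← hφ]
    refine OvoidData.of_bijective hτ hφ0 hfib (fun m => ?_) (fun m => ?_)
    · obtain ⟨x₀, hx₀⟩ : ∃ x₀, x₀ = N m := ⟨_, rfl⟩
      have hm : M x₀ = m := hx₀ ▸ hN m
      refine ⟨fun x => x - x₀, ⟨sub_left_injective, fun y => ⟨y + x₀, by simp⟩⟩, fun x => ?_⟩
      rw [← hx₀, ← hm]
      have h1 := hpol x₀ (x - x₀)
      have h2 := hpol x₀ (-x₀)
      have h3 : φ (-x₀) = φ x₀ := by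
        have := hsmul (-1) x₀
        simpa using this
      rw [add_sub_cancel, mul_sub, map_sub] at h1
      rw [add_neg_cancel, (hφ0 0).2 rfl, h3, mul_neg, map_neg] at h2
      linear_combination -h1 + h2
    · rw [neg_eq_zero, hφ0]
      constructor
      · intro h
        rw [← hN m, h, hM0]
      · rintro rfl
        exact hMb.1 (by rw [hN, hM0])
  · intro x
    have : N (2 * α * x + (β - conj F β) * conj F x) = x := hMb.1 (by rw [hN, hM])
    simp only [this, hφ]

theorem exists_not_mem_range (hFK : Module.finrank F K = 2) :
    ∃ β : K, β ∉ Set.range (algebraMap F K) := by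
  by_contra! h
  have h1 : Function.Bijective (algebraMap F K) := ⟨(algebraMap F K).injective, h⟩
  have h2 := Nat.card_congr (Equiv.ofBijective _ h1)
  rw [natCard_eq_sq hFK] at h2
  have : 1 < Nat.card F := Finite.one_lt_card
  nlinarith

theorem coord_mul_norm {τ : K →ₗ[F] F} {β : K} (hβ : τ β = 1) {x : K} {f : F}
    (hf : algebraMap F K f = x * conj F x) : τ (0 * x ^ 2 + β * (x * conj F x)) = f := by
  rw [zero_mul, zero_add, ← hf, mul_comm, map_algebraMap_mul, hβ, mul_one]

/-- For `α = 0` the function `φ` is the norm to `F`, which is anisotropic without further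
conditions. This case serves both the Hermitian curve and the count of elements of given norm. -/
theorem bm_norm_ovoidData {τ : K →ₗ[F] F} (hτ : IsCoord τ) (hFK : Module.finrank F K = 2) {β : K}
    (hβ : τ β = 1) :
    ∃ G : K → F, OvoidData τ (fun x => τ (0 * x ^ 2 + β * (x * conj F x))) G := by
  have hβ' : β ∉ Set.range (algebraMap F K) := by
    rw [← hτ, hβ]
    exact one_ne_zero
  obtain ⟨G, hG, -⟩ := bm_ovoidData (α := 0) (β := β) hτ hFK (by
      rw [bmDisc, zero_mul, mul_zero, add_zero]
      exact pow_ne_zero 2 (sub_ne_zero.2 fun h => hβ' (conj_eq_self_iff.1 h.symm))) (by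
      intro x hx
      obtain ⟨f, hf⟩ := exists_mul_conj hFK x
      rw [coord_mul_norm hβ hf] at hx
      rw [hx, map_zero, eq_comm, mul_eq_zero, conj_eq_zero, or_self] at hf
      exact hf)
  exact ⟨G, hG⟩

theorem ncard_mul_conj_eq (hFK : Module.finrank F K = 2) {c : F} (hc : c ≠ 0) :
    {x : K | x * conj F x = algebraMap F K c}.ncard = Nat.card F + 1 := by
  obtain ⟨β, hβ⟩ := exists_not_mem_range hFK
  obtain ⟨τ, hτ, hτβ, -⟩ := exists_coord hFK hβ
  obtain ⟨G, hG⟩ := bm_norm_ovoidData hτ hFK hτβ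
  have h := hG.ncard 0 c (by rw [(hG.zero 0).2 rfl]; exact hc)
  rw [← h]
  congr 1
  ext x
  obtain ⟨f, hf⟩ := exists_mul_conj hFK x
  simp only [Set.mem_ofPred_eq]
  rw [coord_mul_norm hτβ hf, ← hf]
  simp

theorem exists_mul_conj_eq (hFK : Module.finrank F K = 2) {c : F} (hc : c ≠ 0) :
    ∃ x : K, x * conj F x = algebraMap F K c := by
  have h := ncard_mul_conj_eq hFK hc
  have h' : {x : K | x * conj F x = algebraMap F K c}.Nonempty := by
    rw [Set.nonempty_iff_ne_empty]
    intro he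
    rw [he, Set.ncard_empty] at h
    omega
  exact h'

end Ovoid

/-! ### The parameters of orthogonal Buekenhout-Metz unitals. -/

section BuekenhoutMetz

variable {F K : Type*} [Field F] [Field K] [Finite F] [Finite K] [Algebra F K]

theorem two_eq_zero_of_even_card (h : Even (Nat.card F)) : (2 : F) = 0 := by
  have := Fintype.ofFinite F
  rw [Nat.card_eq_fintype_card, Nat.even_iff, ← FiniteField.even_card_iff_char_two] at h
  have := ringChar.charP F
  rw [h] at this
  exact CharTwo.two_eq_zero

/-- The sum telescopes in characteristic 2, leaving its two end terms `v` and `v ^ q`. -/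
theorem absTrace₂_add_sq {c : F} (h : Even (Nat.card F)) {v : K}
    (hv : algebraMap F K c = v + v ^ 2) : algebraMap F K (absTrace₂ c) = v + conj F v := by
  have h2 := two_eq_zero_of_even_card h
  have h2K : (2 : K) = 0 := by
    rw [← map_ofNat (algebraMap F K) 2, h2, map_zero]
  have hchar : CharP F 2 := CharTwo.of_one_ne_zero_of_two_eq_zero one_ne_zero h2
  have hcharK : CharP K 2 := CharTwo.of_one_ne_zero_of_two_eq_zero one_ne_zero h2K
  have := Fintype.ofFinite F
  obtain ⟨n, -, hn⟩ := FiniteField.card F 2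
  have key : ∀ k : ℕ, ∑ i ∈ Finset.range k, (v + v ^ 2) ^ 2 ^ i = v + v ^ 2 ^ k := by
    intro k
    induction k with
    | zero => rw [Finset.sum_range_zero, pow_zero, pow_one, CharTwo.add_self_eq_zero]
    | succ k ih =>
      rw [Finset.sum_range_succ, ih, add_pow_char_pow, ← pow_mul, ← pow_succ']
      linear_combination v ^ 2 ^ k * h2K
  rw [absTrace₂, map_sum, conj_apply, Nat.card_eq_fintype_card, hn, Nat.log_pow one_lt_two]
  rw [← key]
  simp [hv]

theorem BMCondition.bmDisc_ne_zero {α β : K} (h : BMCondition F α β) : bmDisc F α β ≠ 0 := by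
  rw [BMCondition] at h
  simp only [pow_card_add_one, ← conj_apply] at h
  rcases h with ⟨-, d, hd, hd'⟩ | ⟨he, hβ, -⟩
  · rw [bmDisc, ← hd', map_ne_zero]
    rintro rfl
    exact hd (IsSquare.zero)
  · have h4 : (4 : K) = 0 := by
      have h2 := congrArg (algebraMap F K) (two_eq_zero_of_even_card he)
      rw [map_ofNat, map_zero] at h2
      linear_combination (2 : K) * h2
    rw [bmDisc, h4, zero_mul, add_zero]
    exact pow_ne_zero 2 (sub_ne_zero.2 fun h => hβ (conj_eq_self_iff.1 h.symm))

/-- A nonzero zero `x` makes `α x² + β N(x)` fixed by conjugation. For odd `q` the discriminant is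
then the square of `(α x² + conj F (α x²)) / N(x)`, an element of `F`. For even `q` it gives a root
of `v + v² = c` with `v + conj F v = 1`, so that `c` has absolute trace `1`. -/
theorem BMCondition.anisotropic (hFK : Module.finrank F K = 2) {α β : K} (h : BMCondition F α β)
    {τ : K →ₗ[F] F} (hτ : IsCoord τ) (x : K) (hx : τ (α * x ^ 2 + β * (x * conj F x)) = 0) :
    x = 0 := by
  by_contra hx0
  have hx0' : conj F x ≠ 0 := mt conj_eq_zero.1 hx0
  rw [hτ, ← conj_eq_self_iff] at hx
  simp only [map_add, map_mul, map_pow, conj_conj hFK] at hx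
  rw [BMCondition] at h
  simp only [pow_card_add_one, ← conj_apply] at h
  rcases h with ⟨-, d, hd, hd'⟩ | ⟨he, hβ, c, hc, hc'⟩
  · obtain ⟨s, hs⟩ := conj_eq_self_iff.1 (show conj F (α * x ^ 2 + conj F α * conj F x ^ 2) =
      α * x ^ 2 + conj F α * conj F x ^ 2 by
        simp only [map_add, map_mul, map_pow, conj_conj hFK]; ring)
    obtain ⟨n, hn⟩ := exists_mul_conj hFK x
    have hn0 : n ≠ 0 := by
      rintro rfl
      rw [map_zero] at hn
      exact mul_ne_zero hx0 hx0' hn.symm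
    apply hd
    refine ⟨s / n, ?_⟩
    have : d * n ^ 2 = s ^ 2 := by
      apply (algebraMap F K).injective
      rw [map_mul, map_pow, map_pow, hd', hs, hn]
      linear_combination
        ((α * x ^ 2 - conj F α * conj F x ^ 2) - (β - conj F β) * (x * conj F x)) * hx
    field_simp
    exact this
  · have h2 := congrArg (algebraMap F K) (two_eq_zero_of_even_card he)
    rw [map_ofNat, map_zero] at h2
    have hγ : β + conj F β ≠ 0 := by
      intro h
      refine hβ (conj_eq_self_iff.1 ?_)
      linear_combination h - β * h2
    obtain ⟨v, hv⟩ : ∃ v, v = α * x / ((β + conj F β) * conj F x) := ⟨_, rfl⟩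
    have hvc : conj F v = conj F α * conj F x / ((β + conj F β) * x) := by
      rw [hv]
      simp only [map_add, map_mul, map_div₀, conj_conj hFK]
      rw [add_comm]
    have hv1 : v + conj F v = 1 := by
      rw [hvc, hv]
      field_simp
      linear_combination hx + (α * x ^ 2 - conj F β * (x * conj F x)) * h2
    have hcv : algebraMap F K c = v + v ^ 2 := by
      have : algebraMap F K c = v * conj F v := by
        rw [hc', hvc, hv]
        field_simp
      rw [this]
      linear_combination v * hv1 - v ^ 2 * h2
    have h3 := absTrace₂_add_sq he hcv
    rw [hc, hv1, map_zero] at h3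
    exact zero_ne_one h3

/-- The left side is a polynomial in `x` of degree at most `2 q < q ^ 2`, so it vanishes
identically; for `q > 2` the exponents `2`, `q + 1`, `2 q` are distinct. -/
theorem eq_zero_of_forall_quadratic_eq_zero (hFK : Module.finrank F K = 2) (hq : 2 < Nat.card F)
    {A B C : K} (h : ∀ x : K, A * x ^ 2 + B * (x * conj F x) + C * conj F x ^ 2 = 0) :
    A = 0 ∧ B = 0 := by
  have := Fintype.ofFinite K
  obtain ⟨q, hq'⟩ : ∃ q, q = Nat.card F := ⟨_, rfl⟩
  have hK : Fintype.card K = q ^ 2 := by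
    rw [← Nat.card_eq_fintype_card, natCard_eq_sq hFK, hq']
  rw [← hq'] at hq
  obtain ⟨p, hp⟩ : ∃ p : Polynomial K, p = Polynomial.C A * Polynomial.X ^ 2 +
    Polynomial.C B * Polynomial.X ^ (q + 1) + Polynomial.C C * Polynomial.X ^ (2 * q) := ⟨_, rfl⟩
  have hp0 : p = 0 := by
    refine Polynomial.eq_zero_of_natDegree_lt_card_of_eval_eq_zero' p Finset.univ ?_ ?_
    · intro x _
      rw [← h x, hp, conj_apply, ← hq']
      simp only [Polynomial.eval_add, Polynomial.eval_mul, Polynomial.eval_C, Polynomial.eval_pow,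
        Polynomial.eval_X]
      ring
    · rw [Finset.card_univ, hK]
      have hle : p.natDegree ≤ 2 * q := by
        rw [hp]
        refine Polynomial.natDegree_add_le_of_degree_le (Polynomial.natDegree_add_le_of_degree_le
          ?_ ?_) (Polynomial.natDegree_C_mul_X_pow_le _ _) <;>
        exact (Polynomial.natDegree_C_mul_X_pow_le _ _).trans (by omega)
      nlinarith
  have hA := congrArg (fun p => Polynomial.coeff p 2) hp0
  have hB := congrArg (fun p => Polynomial.coeff p (q + 1)) hp0
  simp only [hp, Polynomial.coeff_add, Polynomial.coeff_C_mul, Polynomial.coeff_X_pow,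
    Polynomial.coeff_zero] at hA hB
  rw [if_pos trivial, if_neg (by omega), if_neg (by omega)] at hA
  rw [if_neg (by omega), if_pos trivial, if_neg (by omega)] at hB
  constructor
  · simpa using hA
  · simpa using hB

/-- Substituting the parametrisation of `G` into `G = k N` gives a polynomial identity in `x` and
`conj F x`. If `α ≠ 0`, its `x²` coefficient gives `2 ε k γ = 1`, and its mixed coefficient then
turns into the vanishing of the discriminant. -/
theorem bm_eq_zero_of_dual_eq_norm (hFK : Module.finrank F K = 2) (hq : 2 < Nat.card F)
    {τ : K →ₗ[F] F} (hτ : IsCoord τ) {β₀ : K} (hβ₀ : τ β₀ = 1) {α β : K}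
    (hD : bmDisc F α β ≠ 0) {G : K → F}
    (hG : ∀ x, G (2 * α * x + (β - conj F β) * conj F x) = -τ (α * x ^ 2 + β * (x * conj F x)))
    {k : K} (hk : ∀ m, algebraMap F K (G m) = k * (m * conj F m)) : α = 0 := by
  by_contra hα
  obtain ⟨ε, hε⟩ : ∃ ε, ε = β₀ - conj F β₀ := ⟨_, rfl⟩
  obtain ⟨γ, hγ⟩ : ∃ γ, γ = β - conj F β := ⟨_, rfl⟩
  have hγc : conj F γ = -γ := by rw [hγ, map_sub, conj_conj hFK]; ring
  obtain ⟨hA, hB⟩ := eq_zero_of_forall_quadratic_eq_zero hFK hq (A := -α + 2 * ε * k * α * γ)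
    (B := -γ - ε * k * (4 * (α * conj F α) - γ ^ 2)) (C := conj F α - 2 * ε * k * conj F α * γ) (by
      intro x
      have h1 := hτ.mul_sub_conj hβ₀ (α * x ^ 2 + β * (x * conj F x))
      have h2 := hG x
      rw [← hγ] at h2
      have h3 := hk (2 * α * x + γ * conj F x)
      rw [h2, map_neg] at h3
      simp only [map_add, map_mul, map_pow, map_ofNat, conj_conj hFK, hγc] at h1 h3
      rw [← hε] at h1
      linear_combination ε * h3 + h1 - (x * conj F x) * hγ)
  have h1 : 2 * ε * k * γ = 1 := by
    apply mul_left_cancel₀ hα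
    linear_combination hA
  apply hD
  rw [bmDisc, ← hγ]
  linear_combination -2 * γ * hB - (4 * (α * conj F α) - γ ^ 2) * h1

end BuekenhoutMetz

/-! ### The Tits function and its dual. -/

section BuekenhoutTits

variable {F K : Type*} [Field F] [Field K] [Finite F] [Finite K] [Algebra F K]

/-- For `x ≠ 0` the scaling `z = y / (x * s x)` reduces the equation to `1 + z + s z = 0`. Applying
`s` and adding gives `z² + z = 0`, and neither root satisfies the reduced equation. -/
theorem tits_eq_zero {s : F →+* F} (hs : ∀ x, s (s x) = x ^ 2) (h2 : (2 : F) = 0) {x y : F}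
    (h : s x * x ^ 2 + x * y + s y = 0) : x = 0 ∧ y = 0 := by
  by_cases hx : x = 0
  · subst hx
    simpa using h
  exfalso
  have hsx : s x ≠ 0 := (map_ne_zero s).2 hx
  obtain ⟨z, hz⟩ : ∃ z, z = y / (x * s x) := ⟨_, rfl⟩
  have hy : y = z * (x * s x) := by rw [hz]; field_simp
  have h1 : 1 + z + s z = 0 := by
    rw [hy, map_mul, map_mul, hs] at h
    have : s x * x ^ 2 * (1 + z + s z) = 0 := by linear_combination h
    exact (mul_eq_zero.1 this).resolve_left (mul_ne_zero hsx (pow_ne_zero 2 hx))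
  have h3 := congrArg s h1
  rw [map_add, map_add, map_one, hs, map_zero] at h3
  have h4 : z * (1 + z) = 0 := by linear_combination h1 + h3 - (1 + s z) * h2
  rcases mul_eq_zero.1 h4 with h5 | h5
  · rw [h5] at h1
    simp at h1
  · have h6 : z = -1 := by linear_combination h5
    rw [h6, map_neg, map_one] at h1
    simp at h1

/-- For `r = l / n` one has `s r * r² = 1`. Applying `s` yields `(s r * r)² = 1`, so `s r * r = 1`
and hence `r = 1`. -/
theorem tits_weight_injective {s : F →+* F} (hs : ∀ x, s (s x) = x ^ 2) (h2 : (2 : F) = 0)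
    {l n : F} (hn : n ≠ 0) (h : s l * l ^ 2 = s n * n ^ 2) : l = n := by
  have hsn : s n ≠ 0 := (map_ne_zero s).2 hn
  have h1 : s (l / n) * (l / n) ^ 2 = 1 := by
    rw [map_div₀]
    field_simp
    exact h
  obtain ⟨r, hr⟩ : ∃ r, r = l / n := ⟨_, rfl⟩
  rw [← hr] at h1
  have h3 := congrArg s h1
  rw [map_mul, map_pow, hs, map_one] at h3
  have h4 : (s r * r - 1) ^ 2 = 0 := by linear_combination h3 + (1 - s r * r) * h2
  have h5 : s r * r = 1 := by
    rw [← sub_eq_zero]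
    exact pow_eq_zero_iff two_ne_zero |>.1 h4
  have h6 : r = 1 := by linear_combination h1 - r * h5
  rw [hr, div_eq_one_iff_eq hn] at h6
  exact h6

/-- The function is weighted homogeneous: `(x, y) ↦ (l x, l s(l) y)` multiplies it by `s(l) l²`.
This replaces the scalar action of the quadratic case in the fibre count, and a sheared translation
replaces completing the square. -/
theorem tits_ovoidData (hFK : Module.finrank F K = 2) (hq : 2 < Nat.card F) {s : F →+* F}
    (hs : ∀ x, s (s x) = x ^ 2) (h2 : (2 : F) = 0) {τ : K →ₗ[F] F} (hτ : IsCoord τ) {β : K}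
    (hβ : τ β = 1) (hrep : ∀ w, ∃ x : F, w = algebraMap F K x + algebraMap F K (τ w) * β) :
    ∃ φ G : K → F, OvoidData τ φ G ∧
      (∀ x y, φ (algebraMap F K x + algebraMap F K y * β) = s x * x ^ 2 + x * y + s y) ∧
      ∀ k, ∃ m, algebraMap F K (G m) ≠ k * (m * conj F m) := by
  choose X hX using hrep
  have hτe : ∀ x y : F, τ (algebraMap F K x + algebraMap F K y * β) = y := by
    intro x y
    rw [map_add, hτ.map_algebraMap, map_algebraMap_mul, hβ, mul_one, zero_add]
  have hXe : ∀ x y : F, X (algebraMap F K x + algebraMap F K y * β) = x := by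
    intro x y
    have h := hX (algebraMap F K x + algebraMap F K y * β)
    rw [hτe] at h
    exact ((algebraMap F K).injective (add_right_cancel h)).symm
  have hext : ∀ w w', X w = X w' → τ w = τ w' → w = w' := by
    intro w w' h h'
    rw [hX w, hX w', h, h']
  have hτmul : ∀ m w, τ (m * w) = X w * τ m + τ w * τ (m * β) := by
    intro m w
    conv_lhs => rw [hX w]
    rw [mul_add, mul_left_comm, map_add, map_algebraMap_mul, mul_comm, map_algebraMap_mul]
  obtain ⟨f, hf⟩ : ∃ f : F → F → F, f = fun x y => s x * x ^ 2 + x * y + s y := ⟨_, rfl⟩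
  have hf0 : ∀ x y, f x y = 0 → x = 0 ∧ y = 0 := by
    intro x y h
    rw [hf] at h
    exact tits_eq_zero hs h2 h
  obtain ⟨φ, hφ⟩ : ∃ φ : K → F, φ = fun w => f (X w) (τ w) := ⟨_, rfl⟩
  have hX0 : X 0 = 0 := by simpa using hXe 0 0
  have hf00 : f 0 0 = 0 := by simp [hf]
  have hφ0 : ∀ w, φ w = 0 ↔ w = 0 := by
    intro w
    constructor
    · intro h
      rw [hφ] at h
      obtain ⟨h1, h3⟩ := hf0 _ _ h
      exact hext _ _ (h1.trans hX0.symm) (h3.trans (map_zero τ).symm)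
    · rintro rfl
      rw [hφ]
      simp only [hX0, map_zero, hf00]
  have hweight : ∀ l x y, f (l * x) (l * s l * y) = s l * l ^ 2 * f x y := by
    intro l x y
    simp only [hf, map_mul, hs]
    ring
  obtain ⟨G, hG⟩ : ∃ G : K → F, G = fun m => f (τ (m * β)) (τ m + s (τ (m * β)) * τ (m * β)) :=
    ⟨_, rfl⟩
  refine ⟨φ, G, OvoidData.of_bijective hτ hφ0 (ncard_fiber hFK φ hφ0 ?_) ?_ ?_, ?_, ?_⟩
  · intro c hc
    refine ⟨fun p => algebraMap F K (p.2 * X p.1) + algebraMap F K (p.2 * s p.2 * τ p.1) * β,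
      ?_, ?_⟩
    · rintro ⟨⟨w, hw⟩, l⟩ ⟨⟨w', hw'⟩, n⟩ h
      simp only at h
      have h1 := congrArg X h
      have h3 := congrArg τ h
      rw [hXe, hXe] at h1
      rw [hτe, hτe] at h3
      have h4 : s (l : F) * (l : F) ^ 2 = s (n : F) * (n : F) ^ 2 := by
        have h5 := hweight l (X w) (τ w)
        rw [h1, h3, hweight] at h5
        rw [hφ] at hw hw'
        simp only at hw hw'
        rw [hw, hw'] at h5
        exact (mul_right_cancel₀ hc h5).symm
      have hln : (l : F) = n := tits_weight_injective hs h2 n.ne_zero h4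
      rw [hln] at h1 h3
      have h5 : w = w' := hext _ _ (mul_left_cancel₀ n.ne_zero h1)
        (mul_left_cancel₀ (mul_ne_zero n.ne_zero ((map_ne_zero s).2 n.ne_zero)) h3)
      subst h5
      rw [Units.ext hln]
    · rintro ⟨⟨w, hw⟩, l⟩ h
      have h1 := hXe (l * X w) (l * s l * τ w)
      have h3 := hτe (l * X w) (l * s l * τ w)
      simp only at h
      rw [h, hX0] at h1
      rw [h, map_zero] at h3
      have h5 := hweight l (X w) (τ w)
      rw [← h1, ← h3, hf00] at h5
      rw [hφ] at hw
      simp only at hw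
      rw [hw] at h5
      exact mul_ne_zero (mul_ne_zero ((map_ne_zero s).2 l.ne_zero) (pow_ne_zero 2 l.ne_zero)) hc
        h5.symm
  · intro m
    obtain ⟨a, ha⟩ : ∃ a, a = τ (m * β) := ⟨_, rfl⟩
    -- The shift of `X` by `a` creates the terms `a² s(X)` and `s(a) X²`; the shear `s a * X` of the
    -- other coordinate cancels both, as `s (s a) = a²`. What remains is linear in `w`, plus the
    -- constant `G m`.
    refine ⟨fun w => algebraMap F K (X w + a) +
      algebraMap F K (τ w + (τ m + s a * a) + s a * X w) * β, ?_, ?_⟩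
    · rw [← Finite.injective_iff_bijective]
      intro w w' h
      have h1 := congrArg X h
      have h3 := congrArg τ h
      simp only at h1 h3
      rw [hXe, hXe] at h1
      rw [hτe, hτe] at h3
      have h4 : X w = X w' := add_right_cancel h1
      rw [h4] at h3
      exact hext _ _ h4 (add_right_cancel (add_right_cancel h3))
    · intro w
      rw [hφ]
      simp only
      rw [hXe, hτe, hτmul, hG]
      simp only
      rw [← ha, hf]
      simp only [map_add, map_mul, hs]
      linear_combination
        (s a * a ^ 2 + a * τ m + X w * τ m + τ w * a + s (τ m) + s a * a ^ 2 + a ^ 2 * s a +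
          s (X w) * X w * a + s a * X w * a + X w ^ 2 * s a + s (X w) * a ^ 2 + s a * X w * a) * h2
  · intro m
    rw [hG]
    simp only
    constructor
    · intro h
      obtain ⟨h1, h3⟩ := hf0 _ _ h
      rw [h1, mul_zero, add_zero] at h3
      by_contra hm
      have h4 := hτmul m (m⁻¹ * β)
      rw [h1, h3, mul_inv_cancel_left₀ hm, hβ] at h4
      simp at h4
    · rintro rfl
      simp [hf]
  · intro x y
    rw [hφ]
    simp only
    rw [hXe, hτe, hf]
  · by_contra! h
    obtain ⟨k, hk⟩ := h
    have hβ0 : β ≠ 0 := by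
      rintro rfl
      simp at hβ
    have ht0 : τ β⁻¹ ≠ 0 := by
      rw [Ne, hτ]
      rintro ⟨y, hy⟩
      have : β = algebraMap F K y⁻¹ := by rw [map_inv₀, hy, inv_inv]
      rw [this, hτ.map_algebraMap] at hβ
      exact zero_ne_one hβ
    -- On the line `F β⁻¹` the function `G` grows like `s l`, a multiple of the norm like `l²`.
    -- Equality would make `s` the squaring map, and `s (s l) = l²` would then leave only two
    -- elements in `F`.
    have hval : ∀ l : F, algebraMap F K (s l * s (τ β⁻¹)) =
        algebraMap F K l ^ 2 * (k * (β⁻¹ * conj F β⁻¹)) := by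
      intro l
      have h1 := hk (algebraMap F K l * β⁻¹)
      rw [hG] at h1
      simp only at h1
      rw [mul_assoc, inv_mul_cancel₀ hβ0, mul_one, hτ.map_algebraMap, map_algebraMap_mul, hf] at h1
      simp only [map_zero, zero_mul, zero_add, mul_zero, add_zero] at h1
      rw [← map_mul, h1, map_mul (conj F), AlgHom.commutes]
      ring
    have hsq : ∀ l : F, s l = l ^ 2 := by
      intro l
      have h1 := hval l
      have h3 := hval 1
      rw [map_one, map_one, one_pow, one_mul, one_mul] at h3
      exact mul_right_cancel₀ ((map_ne_zero s).2 ht0) ((algebraMap F K).injective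
        (by rw [h1, map_mul, map_pow, h3]))
    have hidem : ∀ l : F, l = 0 ∨ l = 1 := by
      intro l
      have h1 := hs l
      rw [hsq l, map_pow, hsq l] at h1
      have h3 : (l * (l - 1)) ^ 2 = 0 := by linear_combination h1 + (l ^ 2 - l ^ 3) * h2
      rcases mul_eq_zero.1 (pow_eq_zero_iff two_ne_zero |>.1 h3) with h | h
      · exact Or.inl h
      · exact Or.inr (sub_eq_zero.1 h)
    have hcard : Nat.card F ≤ Nat.card Bool := by
      classical
      refine Nat.card_le_card_of_injective (fun l : F => decide (l = 0)) ?_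
      intro l l' h
      simp only [decide_eq_decide] at h
      rcases hidem l with h1 | h1
      · rw [h1, h.1 h1]
      · rcases hidem l' with h3 | h3
        · rw [h3, h.2 h3]
        · rw [h1, h3]
    rw [Nat.card_eq_fintype_card (α := Bool), Fintype.card_bool] at hcard
    omega

end BuekenhoutTits

/-! ### Block graphs of designs: strong regularity and a count of quadrangles. -/

section Design

open Finset

variable {V T : Type*}

/-- The graph on the blocks of an incidence structure, two blocks being adjacent if they meet. -/
def blockGraph (I : V → T → Prop) : SimpleGraph V where
  Adj v w := v ≠ w ∧ ∃ t, I v t ∧ I w t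
  symm := ⟨fun _ _ ⟨h, t, h1, h2⟩ => ⟨h.symm, t, h2, h1⟩⟩
  loopless := ⟨fun _ h => h.1 rfl⟩

/-- Four blocks, any two of which meet, no three of them in the same point. -/
structure IsQuadrangle (I : V → T → Prop) (v w x y : V) : Prop where
  vw : (blockGraph I).Adj v w
  vx : (blockGraph I).Adj v x
  vy : (blockGraph I).Adj v y
  wx : (blockGraph I).Adj w x
  wy : (blockGraph I).Adj w y
  xy : (blockGraph I).Adj x y
  vwx : ∀ t, I v t → I w t → ¬ I x t
  vwy : ∀ t, I v t → I w t → ¬ I y t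
  vxy : ∀ t, I v t → I x t → ¬ I y t
  wxy : ∀ t, I w t → I x t → ¬ I y t

/-- The incidence structure `I` is (the dual of) a design: any two points lie on a unique block,
each block has `k` points, and each point lies on `r` blocks. -/
structure IsDesign (I : V → T → Prop) (k r : ℕ) : Prop where
  ncard_points : ∀ v, {t | I v t}.ncard = k
  ncard_blocks : ∀ t, {v | I v t}.ncard = r
  inter : ∀ t t', t ≠ t' → ∃! v, I v t ∧ I v t'

namespace IsDesign

variable {I : V → T → Prop} {k r : ℕ} (hI : IsDesign I k r)
include hI

theorem eq_of_mem {v w : V} {t t' : T} (hvw : v ≠ w) (h1 : I v t) (h2 : I w t) (h3 : I v t')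
    (h4 : I w t') : t = t' := by
  by_contra h
  exact hvw ((hI.inter t t' h).unique ⟨h1, h3⟩ ⟨h2, h4⟩)

variable [Fintype V] [Fintype T]

open scoped Classical in
theorem card_points (v : V) : (univ.filter fun t => I v t).card = k := by
  rw [← hI.ncard_points v, Set.ncard_eq_toFinset_card']
  congr 1
  ext
  simp

open scoped Classical in
theorem card_blocks (t : T) : (univ.filter fun v => I v t).card = r := by
  rw [← hI.ncard_blocks t, Set.ncard_eq_toFinset_card']
  congr 1
  ext
  simp

open scoped Classical in
/-- The blocks that meet both `v` and `w` in prescribed, disjoint sets of points. -/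
theorem card_grid {v w : V} {A B : Finset T} (hA : ∀ a ∈ A, I v a ∧ ¬ I w a)
    (hB : ∀ b ∈ B, I w b ∧ ¬ I v b) :
    (univ.filter fun x => ∃ a ∈ A, ∃ b ∈ B, I x a ∧ I x b).card = A.card * B.card := by
  have hne : ∀ a ∈ A, ∀ b ∈ B, a ≠ b := by
    rintro a ha _ hb rfl
    exact (hA a ha).2 (hB a hb).1
  rw [← card_product]
  symm
  refine card_bij (fun p hp => (hI.inter p.1 p.2 (hne _ (mem_product.1 hp).1 _
    (mem_product.1 hp).2)).choose) ?_ ?_ ?_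
  · rintro ⟨a, b⟩ hp
    have := (hI.inter a b (hne _ (mem_product.1 hp).1 _ (mem_product.1 hp).2)).choose_spec.1
    exact mem_filter.2 ⟨mem_univ _, a, (mem_product.1 hp).1, b, (mem_product.1 hp).2, this⟩
  · rintro ⟨a, b⟩ hp ⟨a', b'⟩ hp' h
    obtain ⟨ha, hb⟩ := mem_product.1 hp
    obtain ⟨ha', hb'⟩ := mem_product.1 hp'
    have h1 := (hI.inter a b (hne _ ha _ hb)).choose_spec.1
    have h2 := (hI.inter a' b' (hne _ ha' _ hb')).choose_spec.1
    simp only at h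
    rw [← h] at h2
    generalize (hI.inter a b (hne _ ha _ hb)).choose = x at h1 h2
    have hxv : x ≠ v := by
      rintro rfl
      exact (hB b hb).2 h1.2
    have hxw : x ≠ w := by
      rintro rfl
      exact (hA a ha).2 h1.1
    rw [hI.eq_of_mem hxv h1.1 (hA a ha).1 h2.1 (hA a' ha').1,
      hI.eq_of_mem hxw h1.2 (hB b hb).1 h2.2 (hB b' hb').1]
  · intro x hx
    obtain ⟨-, a, ha, b, hb, hxa, hxb⟩ := mem_filter.1 hx
    refine ⟨(a, b), mem_product.2 ⟨ha, hb⟩, ?_⟩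
    exact (hI.inter a b (hne _ ha _ hb)).unique
      (hI.inter a b (hne _ ha _ hb)).choose_spec.1 ⟨hxa, hxb⟩

open scoped Classical in
-- Each of the `k` points of `y` is joined to `t` by one block, and different points give different
-- blocks because `y` misses `t`.
theorem card_transversal {y : V} {t : T} (hy : ¬ I y t) :
    (univ.filter fun x => I x t ∧ (blockGraph I).Adj y x).card = k := by
  have hne : ∀ c ∈ univ.filter fun c => I y c, c ≠ t := by
    rintro _ hc rfl
    exact hy (mem_filter.1 hc).2
  rw [← hI.card_points y]
  symm
  refine card_bij (fun c hc => (hI.inter c t (hne c hc)).choose) ?_ ?_ ?_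
  · intro c hc
    have := (hI.inter c t (hne c hc)).choose_spec.1
    refine mem_filter.2 ⟨mem_univ _, this.2, ?_, c, (mem_filter.1 hc).2, this.1⟩
    rintro h
    rw [← h] at this
    exact hy this.2
  · intro c hc c' hc' h
    have h1 := (hI.inter c t (hne c hc)).choose_spec.1
    have h2 := (hI.inter c' t (hne c' hc')).choose_spec.1
    simp only at h
    rw [← h] at h2
    refine hI.eq_of_mem ?_ h1.1 (mem_filter.1 hc).2 h2.1 (mem_filter.1 hc').2
    intro h
    rw [h] at h1
    exact hy h1.2
  · intro x hx
    obtain ⟨-, hxt, -, c, hyc, hxc⟩ := mem_filter.1 hx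
    have hc : c ∈ univ.filter fun c => I y c := mem_filter.2 ⟨mem_univ _, hyc⟩
    exact ⟨c, hc, (hI.inter c t (hne c hc)).unique (hI.inter c t (hne c hc)).choose_spec.1
      ⟨hxc, hxt⟩⟩

open scoped Classical in
theorem card_neighbors (v : V) :
    (univ.filter fun w => (blockGraph I).Adj v w).card = k * (r - 1) := by
  have h : (univ.filter fun w => (blockGraph I).Adj v w) =
      (univ.filter fun t => I v t).biUnion fun t => (univ.filter fun w => I w t).erase v := by
    ext w
    simp only [mem_filter, mem_univ, true_and, mem_biUnion, mem_erase]
    constructor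
    · rintro ⟨h, t, h1, h2⟩
      exact ⟨t, h1, h.symm, h2⟩
    · rintro ⟨t, h1, h, h2⟩
      exact ⟨h.symm, t, h1, h2⟩
  rw [h, card_biUnion, sum_const_nat (m := r - 1), hI.card_points]
  · intro t ht
    rw [card_erase_of_mem, hI.card_blocks]
    simpa using ht
  · intro t ht t' ht' htt'
    rw [Function.onFun, disjoint_left]
    intro w hw hw'
    simp only [mem_filter, mem_univ, true_and, mem_erase, coe_filter, Set.mem_ofPred_eq] at *
    exact htt' (hI.eq_of_mem hw.1 hw.2 ht hw'.2 ht')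

open scoped Classical in
/-- The common neighbours of the adjacent blocks `v` and `w` that do not pass through their
common point `t`. -/
noncomputable def grid (_ : IsDesign I k r) (v w : V) (t : T) : Finset V :=
  univ.filter fun x => ∃ a ∈ (univ.filter fun a => I v a).erase t,
    ∃ b ∈ (univ.filter fun b => I w b).erase t, I x a ∧ I x b

section Edge

variable {v w : V} {t : T} (hvw : v ≠ w) (hv : I v t) (hw : I w t)

theorem mem_grid {x : V} : x ∈ hI.grid v w t ↔
    ∃ a b, a ≠ t ∧ I v a ∧ b ≠ t ∧ I w b ∧ I x a ∧ I x b := by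
  simp only [grid, mem_filter, mem_univ, true_and, mem_erase]
  constructor
  · rintro ⟨a, ⟨h1, h2⟩, b, ⟨h3, h4⟩, h5, h6⟩
    exact ⟨a, b, h1, h2, h3, h4, h5, h6⟩
  · rintro ⟨a, b, h1, h2, h3, h4, h5, h6⟩
    exact ⟨a, ⟨h1, h2⟩, b, ⟨h3, h4⟩, h5, h6⟩

include hvw hv hw

theorem card_grid_eq : (hI.grid v w t).card = (k - 1) * (k - 1) := by
  classical
  have hA : ∀ a ∈ (univ.filter fun a => I v a).erase t, I v a ∧ ¬ I w a := by
    intro a ha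
    simp only [mem_filter, mem_univ, true_and, mem_erase] at ha
    exact ⟨ha.2, fun h => ha.1 (hI.eq_of_mem hvw ha.2 h hv hw)⟩
  have hB : ∀ a ∈ (univ.filter fun a => I w a).erase t, I w a ∧ ¬ I v a := by
    intro a ha
    simp only [mem_filter, mem_univ, true_and, mem_erase] at ha
    exact ⟨ha.2, fun h => ha.1 (hI.eq_of_mem hvw h ha.2 hv hw)⟩
  have h := hI.card_grid hA hB
  rw [card_erase_of_mem (by simpa using hv), card_erase_of_mem (by simpa using hw),
    hI.card_points, hI.card_points] at h
  rw [← h, grid]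
  congr

theorem not_mem_of_mem_grid {x : V} (hx : x ∈ hI.grid v w t) : ¬ I x t := by
  obtain ⟨a, b, h1, h2, h3, h4, h5, h6⟩ := hI.mem_grid.1 hx
  intro h
  have hxv : x = v := by
    by_contra hne
    exact h1 (hI.eq_of_mem hne h5 h2 h hv)
  subst hxv
  exact h3 (hI.eq_of_mem hvw h6 h4 h hw)

open scoped Classical in
theorem commonNeighbors_eq :
    (univ.filter fun x => (blockGraph I).Adj v x ∧ (blockGraph I).Adj w x) =
      ((univ.filter fun x => I x t).erase v).erase w ∪ hI.grid v w t := by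
  ext x
  simp only [mem_union, mem_filter, mem_univ, true_and, mem_erase]
  constructor
  · rintro ⟨⟨h1, a, h2, h3⟩, h4, b, h5, h6⟩
    by_cases hx : I x t
    · exact Or.inl ⟨h4.symm, h1.symm, hx⟩
    · refine Or.inr (hI.mem_grid.2 ⟨a, b, ?_, h2, ?_, h5, h3, h6⟩)
      · rintro rfl
        exact hx h3
      · rintro rfl
        exact hx h6
  · rintro (⟨h1, h2, h3⟩ | h)
    · exact ⟨⟨h2.symm, t, hv, h3⟩, h1.symm, t, hw, h3⟩
    · have hxt := hI.not_mem_of_mem_grid hvw hv hw h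
      obtain ⟨a, b, h1, h2, h3, h4, h5, h6⟩ := hI.mem_grid.1 h
      refine ⟨⟨?_, a, h2, h5⟩, ?_, b, h4, h6⟩
      · rintro rfl
        exact hxt hv
      · rintro rfl
        exact hxt hw

open scoped Classical in
theorem card_line_erase : (((univ.filter fun x => I x t).erase v).erase w).card = r - 1 - 1 := by
  rw [card_erase_of_mem, card_erase_of_mem, hI.card_blocks]
  · simpa using hv
  · simpa [hvw.symm] using hw

open scoped Classical in
theorem disjoint_line_grid :
    Disjoint (((univ.filter fun x => I x t).erase v).erase w) (hI.grid v w t) := by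
  rw [disjoint_left]
  intro x hx hx'
  simp only [mem_filter, mem_univ, true_and, mem_erase] at hx
  exact hI.not_mem_of_mem_grid hvw hv hw hx' hx.2.2

open scoped Classical in
theorem card_commonNeighbors :
    (univ.filter fun x => (blockGraph I).Adj v x ∧ (blockGraph I).Adj w x).card =
      (r - 1 - 1) + (k - 1) * (k - 1) := by
  rw [hI.commonNeighbors_eq hvw hv hw, card_union_of_disjoint (hI.disjoint_line_grid hvw hv hw),
    hI.card_grid_eq hvw hv hw, hI.card_line_erase hvw hv hw]

omit hvw in
open scoped Classical in
/-- On a side `vw` of a triangle `vwy` there are `k - 2` further neighbours of `y`. -/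
theorem card_transversal_erase (hvw : v ≠ w) {y : V} (hy : ¬ I y t)
    (hvy : (blockGraph I).Adj y v) (hwy : (blockGraph I).Adj y w) :
    ((((univ.filter fun x => I x t).erase v).erase w).filter fun x =>
      (blockGraph I).Adj y x).card = k - 1 - 1 := by
  have h : ((((univ.filter fun x => I x t).erase v).erase w).filter fun x =>
      (blockGraph I).Adj y x) =
      ((univ.filter fun x => I x t ∧ (blockGraph I).Adj y x).erase v).erase w := by
    ext x
    simp only [mem_filter, mem_univ, true_and, mem_erase]
    tauto
  rw [h, card_erase_of_mem, card_erase_of_mem, hI.card_transversal hy]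
  · simpa using ⟨hv, hvy⟩
  · simpa [hvw.symm] using ⟨hw, hwy⟩

end Edge

open scoped Classical in
theorem card_commonNeighbors_of_not_adj {v w : V} (hvw : v ≠ w) (h : ¬ (blockGraph I).Adj v w) :
    (univ.filter fun x => (blockGraph I).Adj v x ∧ (blockGraph I).Adj w x).card = k * k := by
  have hno : ∀ t, I v t → ¬ I w t := fun t h1 h2 => h ⟨hvw, t, h1, h2⟩
  have hg := hI.card_grid (v := v) (w := w) (A := univ.filter fun a => I v a)
    (B := univ.filter fun b => I w b) (fun a ha => by
      simp only [mem_filter, mem_univ, true_and] at ha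
      exact ⟨ha, hno a ha⟩) (fun a ha => by
      simp only [mem_filter, mem_univ, true_and] at ha
      exact ⟨ha, fun h => hno a h ha⟩)
  rw [hI.card_points, hI.card_points] at hg
  rw [← hg]
  congr 1
  ext x
  simp only [mem_filter, mem_univ, true_and]
  constructor
  · rintro ⟨⟨h1, a, h2, h3⟩, h4, b, h5, h6⟩
    exact ⟨a, h2, b, h5, h3, h6⟩
  · rintro ⟨a, h2, b, h5, h3, h6⟩
    refine ⟨⟨?_, a, h2, h3⟩, ?_, b, h5, h6⟩
    · rintro rfl
      exact hno b h6 h5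
    · rintro rfl
      exact hno a h2 h3

open scoped Classical in
theorem isSRGWith {n : ℕ} (hn : Fintype.card V = n) :
    (blockGraph I).IsSRGWith n (k * (r - 1)) ((r - 1 - 1) + (k - 1) * (k - 1)) (k * k) where
  card := hn
  regular v := by
    rw [← SimpleGraph.card_neighborFinset_eq_degree, ← hI.card_neighbors v]
    congr 1
    ext
    simp
  of_adj v w h := by
    obtain ⟨hvw, t, hv, hw⟩ := h
    rw [← hI.card_commonNeighbors hvw hv hw, Fintype.card_subtype]
    congr 1
  of_not_adj v w hvw h := by
    rw [← hI.card_commonNeighbors_of_not_adj hvw h, Fintype.card_subtype]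
    congr 1

end IsDesign

open scoped Classical in
/-- The number of ordered pairs of adjacent vertices in the common neighbourhood of `v`, `w`. -/
noncomputable def cliqueCount [Fintype V] (G : SimpleGraph V) (v w : V) : ℕ :=
  ∑ y ∈ univ.filter (fun x => G.Adj v x ∧ G.Adj w x),
    ((univ.filter fun x => G.Adj v x ∧ G.Adj w x).filter fun x => G.Adj y x).card

theorem cliqueCount_iso {W : Type*} [Fintype V] [Fintype W] {G : SimpleGraph V}
    {H : SimpleGraph W} (e : G ≃g H) (v w : V) :
    cliqueCount H (e v) (e w) = cliqueCount G v w := by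
  classical
  unfold cliqueCount
  symm
  refine sum_equiv e.toEquiv ?_ ?_
  · intro x
    simp [SimpleGraph.Iso.map_adj_iff]
  · intro y _
    refine card_equiv e.toEquiv ?_
    intro x
    simp [SimpleGraph.Iso.map_adj_iff]

namespace IsDesign

variable {I : V → T → Prop} {k r : ℕ} (hI : IsDesign I k r) [Fintype V] [Fintype T]
include hI

open scoped Classical in
-- The blocks `v`, `w`, `y` form a triangle with vertices `t`, `a`, `b`. A block meeting all three
-- either passes through exactly one vertex, with `k - 2` choices for each, or completes a
-- quadrangle.
theorem card_filter_adj_of_mem_grid {v w y : V} {t : T} (hvw : v ≠ w) (hv : I v t) (hw : I w t)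
    (hy : y ∈ hI.grid v w t) :
    ((univ.filter fun x => (blockGraph I).Adj v x ∧ (blockGraph I).Adj w x).filter fun x =>
      (blockGraph I).Adj y x).card =
      3 * (k - 1 - 1) + (univ.filter fun x => IsQuadrangle I v w y x).card := by
  have hyt := hI.not_mem_of_mem_grid hvw hv hw hy
  obtain ⟨a, b, ha, hva, hb, hwb, hya, hyb⟩ := hI.mem_grid.1 hy
  have hvy : v ≠ y := by rintro rfl; exact hyt hv
  have hwy : w ≠ y := by rintro rfl; exact hyt hw
  have Avw : (blockGraph I).Adj v w := ⟨hvw, t, hv, hw⟩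
  have Avy : (blockGraph I).Adj v y := ⟨hvy, a, hva, hya⟩
  have Awy : (blockGraph I).Adj w y := ⟨hwy, b, hwb, hyb⟩
  have hwa : ¬ I w a := fun h => ha (hI.eq_of_mem hvw hva h hv hw)
  have hvb : ¬ I v b := fun h => hb (hI.eq_of_mem hvw h hwb hv hw)
  have hS : ((univ.filter fun x => (blockGraph I).Adj v x ∧ (blockGraph I).Adj w x).filter
      fun x => (blockGraph I).Adj y x) =
      (((((univ.filter fun x => I x t).erase v).erase w).filter fun x =>
        (blockGraph I).Adj y x) ∪
      ((((univ.filter fun x => I x a).erase v).erase y).filter fun x =>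
        (blockGraph I).Adj w x) ∪
      ((((univ.filter fun x => I x b).erase w).erase y).filter fun x =>
        (blockGraph I).Adj v x)) ∪
      (univ.filter fun x => IsQuadrangle I v w y x) := by
    ext x
    simp only [mem_union, mem_filter, mem_univ, true_and, mem_erase]
    constructor
    · rintro ⟨⟨h1, h2⟩, h3⟩
      by_cases hxt : I x t
      · exact Or.inl (Or.inl (Or.inl ⟨⟨h2.ne', h1.ne', hxt⟩, h3⟩))
      by_cases hxa : I x a
      · exact Or.inl (Or.inl (Or.inr ⟨⟨h3.ne', h1.ne', hxa⟩, h2⟩))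
      by_cases hxb : I x b
      · exact Or.inl (Or.inr ⟨⟨h3.ne', h2.ne', hxb⟩, h1⟩)
      refine Or.inr ⟨Avw, Avy, h1, Awy, h2, h3, ?_, ?_, ?_, ?_⟩
      · intro s h4 h5 h6
        rw [hI.eq_of_mem hvw h4 h5 hv hw] at h6
        exact hyt h6
      · intro s h4 h5 h6
        rw [hI.eq_of_mem hvw h4 h5 hv hw] at h6
        exact hxt h6
      · intro s h4 h5 h6
        rw [hI.eq_of_mem hvy h4 h5 hva hya] at h6
        exact hxa h6
      · intro s h4 h5 h6
        rw [hI.eq_of_mem hwy h4 h5 hwb hyb] at h6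
        exact hxb h6
    · rintro (((⟨⟨h1, h2, h3⟩, h4⟩ | ⟨⟨h1, h2, h3⟩, h4⟩) | ⟨⟨h1, h2, h3⟩, h4⟩) | h)
      · exact ⟨⟨⟨h2.symm, t, hv, h3⟩, h1.symm, t, hw, h3⟩, h4⟩
      · exact ⟨⟨⟨h2.symm, a, hva, h3⟩, h4⟩, h1.symm, a, hya, h3⟩
      · exact ⟨⟨h4, h2.symm, b, hwb, h3⟩, h1.symm, b, hyb, h3⟩
      · exact ⟨⟨h.vy, h.wy⟩, h.xy⟩
  rw [hS, card_union_of_disjoint, card_union_of_disjoint, card_union_of_disjoint,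
    hI.card_transversal_erase hv hw hvw hyt Avy.symm Awy.symm,
    hI.card_transversal_erase hva hya hvy hwa Avw.symm Awy,
    hI.card_transversal_erase hwb hyb hwy hvb Avw Avy]
  · ring
  · rw [disjoint_left]
    intro x hx hx'
    simp only [mem_filter, mem_univ, true_and, mem_erase] at hx hx'
    exact ha (hI.eq_of_mem hx'.1.2.1.symm hva hx'.1.2.2 hv hx.1.2.2) |>.elim
  · rw [disjoint_left]
    intro x hx hx'
    simp only [mem_union, mem_filter, mem_univ, true_and, mem_erase] at hx hx'
    rcases hx with hx | hx
    · exact hb (hI.eq_of_mem hx'.1.2.1.symm hwb hx'.1.2.2 hw hx.1.2.2)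
    · have := hI.eq_of_mem hx'.1.1.symm hya hx.1.2.2 hyb hx'.1.2.2
      rw [this] at hva
      exact hvb hva
  · rw [disjoint_left]
    intro x hx hx'
    simp only [mem_union, mem_filter, mem_univ, true_and, mem_erase] at hx hx'
    rcases hx with (hx | hx) | hx
    · exact hx'.vwy t hv hw hx.1.2.2
    · exact hx'.vxy a hva hya hx.1.2.2
    · exact hx'.wxy b hwb hyb hx.1.2.2

open scoped Classical in
-- Split the common neighbours into the `r - 2` further blocks on `t` and the `(k - 1)²` grid
-- blocks. Blocks on `t` are mutually adjacent; each grid block meets `k - 2` of them, which counts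
-- twice in ordered pairs. Inside the grid, the two other vertices of the triangle contribute twice
-- the same amount, and all else comes from quadrangles.
theorem cliqueCount_eq {v w : V} {t : T} (hvw : v ≠ w) (hv : I v t) (hw : I w t) :
    cliqueCount (blockGraph I) v w =
      (r - 1 - 1) * (r - 1 - 1 - 1) + 4 * ((k - 1) * (k - 1) * (k - 1 - 1)) +
        ∑ y ∈ hI.grid v w t, (univ.filter fun x => IsQuadrangle I v w y x).card := by
  obtain ⟨C, hC⟩ : ∃ C, C =
    univ.filter fun x => (blockGraph I).Adj v x ∧ (blockGraph I).Adj w x := ⟨_, rfl⟩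
  obtain ⟨L, hL⟩ : ∃ L, L = ((univ.filter fun x => I x t).erase v).erase w := ⟨_, rfl⟩
  have hCL : C = L ∪ hI.grid v w t := by
    rw [hC, hL]
    exact hI.commonNeighbors_eq hvw hv hw
  have hdis : Disjoint L (hI.grid v w t) := by
    rw [hL]
    exact hI.disjoint_line_grid hvw hv hw
  have hLc : L.card = r - 1 - 1 := by
    rw [hL]
    exact hI.card_line_erase hvw hv hw
  have hgrid : ∑ y ∈ hI.grid v w t, (C.filter fun x => (blockGraph I).Adj y x).card =
      3 * ((k - 1) * (k - 1) * (k - 1 - 1)) +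
        ∑ y ∈ hI.grid v w t, (univ.filter fun x => IsQuadrangle I v w y x).card := by
    rw [sum_congr rfl fun y hy => (hC ▸ hI.card_filter_adj_of_mem_grid hvw hv hw hy :
      (C.filter fun x => (blockGraph I).Adj y x).card = _), sum_add_distrib, sum_const,
      hI.card_grid_eq hvw hv hw, smul_eq_mul]
    ring
  have hLL : ∀ y ∈ L, (C.filter fun x => (blockGraph I).Adj y x).card =
      (r - 1 - 1 - 1) + ((hI.grid v w t).filter fun x => (blockGraph I).Adj y x).card := by
    intro y hy
    rw [hCL, filter_union, card_union_of_disjoint (disjoint_filter_filter hdis)]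
    congr 1
    rw [← hLc, ← card_erase_of_mem hy]
    congr 1
    ext x
    simp only [mem_filter, mem_erase]
    constructor
    · rintro ⟨h1, h2⟩
      exact ⟨h2.ne', h1⟩
    · rintro ⟨h1, h2⟩
      refine ⟨h2, h1.symm, t, ?_, ?_⟩
      · rw [hL] at hy
        simp only [mem_filter, mem_univ, true_and, mem_erase] at hy
        exact hy.2.2
      · rw [hL] at h2
        simp only [mem_filter, mem_univ, true_and, mem_erase] at h2
        exact h2.2.2
  have hLg : ∑ y ∈ L, ((hI.grid v w t).filter fun x => (blockGraph I).Adj y x).card =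
      (k - 1) * (k - 1) * (k - 1 - 1) := by
    have h := sum_card_bipartiteAbove_eq_sum_card_bipartiteBelow (s := L) (t := hI.grid v w t)
      (fun y x => (blockGraph I).Adj y x)
    simp only [bipartiteAbove, bipartiteBelow] at h
    rw [h, sum_const_nat (m := k - 1 - 1), hI.card_grid_eq hvw hv hw]
    intro y hy
    have hyC : y ∈ C := by
      rw [hCL]
      exact mem_union_right _ hy
    rw [hC] at hyC
    simp only [mem_filter, mem_univ, true_and] at hyC
    rw [← hI.card_transversal_erase hv hw hvw (hI.not_mem_of_mem_grid hvw hv hw hy) hyC.1.symm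
      hyC.2.symm, hL]
    congr 1
    ext x
    simp only [mem_filter, SimpleGraph.adj_comm]
  rw [cliqueCount, ← hC]
  conv_lhs => rw [hCL, sum_union hdis, ← hCL]
  rw [hgrid, sum_congr rfl hLL, sum_add_distrib, hLg, sum_const, hLc, smul_eq_mul]
  ring

theorem cliqueCount_of_forall_not_isQuadrangle (h : ∀ v w x y, ¬ IsQuadrangle I v w x y)
    {v w : V} (hvw : (blockGraph I).Adj v w) : cliqueCount (blockGraph I) v w =
      (r - 1 - 1) * (r - 1 - 1 - 1) + 4 * ((k - 1) * (k - 1) * (k - 1 - 1)) := by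
  obtain ⟨hvw, t, hv, hw⟩ := hvw
  rw [hI.cliqueCount_eq hvw hv hw]
  simp [h]

theorem lt_cliqueCount {v w x y : V} (h : IsQuadrangle I v w x y) :
    (r - 1 - 1) * (r - 1 - 1 - 1) + 4 * ((k - 1) * (k - 1) * (k - 1 - 1)) <
      cliqueCount (blockGraph I) v w := by
  classical
  obtain ⟨hvw, t, hv, hw⟩ := h.vw
  rw [hI.cliqueCount_eq hvw hv hw]
  refine Nat.lt_add_of_pos_right (sum_pos' (fun _ _ => Nat.zero_le _) ⟨x, ?_, card_pos.2 ⟨y, ?_⟩⟩)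
  · obtain ⟨-, a, ha, hxa⟩ := h.vx
    obtain ⟨-, b, hb, hxb⟩ := h.wx
    refine hI.mem_grid.2 ⟨a, b, ?_, ha, ?_, hb, hxa, hxb⟩
    · rintro rfl
      exact h.vwx _ hv hw hxa
    · rintro rfl
      exact h.vwx _ hv hw hxb
  · simpa using h

/-- An edge lying in a quadrangle exceeds the constant that all edges of the other graph attain. -/
theorem isEmpty_iso {V' T' : Type*} [Fintype V'] [Fintype T'] {I' : V' → T' → Prop}
    (hI' : IsDesign I' k r) (h : ∃ v w x y, IsQuadrangle I v w x y)
    (h' : ∀ v w x y, ¬ IsQuadrangle I' v w x y) : IsEmpty (blockGraph I ≃g blockGraph I') := by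
  refine ⟨fun e => ?_⟩
  obtain ⟨v, w, x, y, h⟩ := h
  have h1 := hI.lt_cliqueCount h
  rw [← cliqueCount_iso e, hI'.cliqueCount_of_forall_not_isQuadrangle h'
    (e.map_adj_iff.2 h.vw)] at h1
  exact lt_irrefl _ h1

end IsDesign

end Design

/-! ### Lines and projectivities of the plane. -/

section Lines

variable {K : Type*} [Field K]

/-- The line with equation `v 0 * X₀ + v 1 * X₁ + v 2 * X₂ = 0`. -/
def line (v : Fin 3 → K) : Set (Plane K) := {P | v ⬝ᵥ P.rep = 0}

theorem mk_mem_line {v w : Fin 3 → K} (hw : w ≠ 0) :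
    Projectivization.mk K w hw ∈ line v ↔ v ⬝ᵥ w = 0 := by
  obtain ⟨a, ha⟩ := Projectivization.exists_smul_eq_mk_rep K w hw
  change v ⬝ᵥ (Projectivization.mk K w hw).rep = 0 ↔ _
  rw [← ha, Units.smul_def, dotProduct_smul, smul_eq_mul, mul_eq_zero]
  simp

theorem orthogonal_iff_mem_line (l P : Plane K) :
    Projectivization.orthogonal P l ↔ P ∈ line l.rep := by
  conv_lhs => rw [← P.mk_rep, ← l.mk_rep]
  rw [Projectivization.orthogonal_mk, dotProduct_comm]
  rfl

theorem existsUnique_line {P Q : Plane K} (h : P ≠ Q) :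
    ∃! l : Plane K, P ∈ line l.rep ∧ Q ∈ line l.rep := by
  classical
  have := Configuration.HasLines.existsUnique_line (Plane K) (Plane K) P Q h
  simpa only [Configuration.ofField.mem_iff, orthogonal_iff_mem_line] using this

theorem existsUnique_point {l l' : Plane K} (h : l ≠ l') :
    ∃! P : Plane K, P ∈ line l.rep ∧ P ∈ line l'.rep := by
  classical
  have := Configuration.HasPoints.existsUnique_point (Plane K) (Plane K) l l' h
  simpa only [Configuration.ofField.mem_iff, orthogonal_iff_mem_line] using this

theorem line_rep_mk {v : Fin 3 → K} (hv : v ≠ 0) :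
    line (Projectivization.mk K v hv).rep = line v := by
  ext P
  rw [← orthogonal_iff_mem_line]
  conv_lhs => rw [← P.mk_rep]
  rw [Projectivization.orthogonal_mk, dotProduct_comm]
  rfl

theorem lineThrough_eq_line {P Q : Plane K} (h : P ≠ Q) {v : Fin 3 → K} (hv : v ≠ 0)
    (hP : P ∈ line v) (hQ : Q ∈ line v) : lineThrough P Q = line v := by
  let f : (Fin 3 → K) →ₗ[K] K := dotProductBilin K K v
  have hf : ∀ w, f w = v ⬝ᵥ w := fun w => rfl
  have hsub : ∀ R : Plane K, R.submodule ≤ LinearMap.ker f ↔ R ∈ line v := by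
    intro R
    rw [Projectivization.submodule_eq, Submodule.span_singleton_le_iff_mem, LinearMap.mem_ker, hf]
    rfl
  have hle : P.submodule ⊔ Q.submodule ≤ LinearMap.ker f :=
    sup_le ((hsub P).2 hP) ((hsub Q).2 hQ)
  have hli := (Projectivization.linearIndependent_pair_iff_ne (K := K)).2 h
  have hfr : Module.finrank K ↥(P.submodule ⊔ Q.submodule) = 2 := by
    have := finrank_span_eq_card hli
    rw [Matrix.range_cons, Matrix.range_cons, Matrix.range_empty, Set.union_empty,
      Submodule.span_union, ← Projectivization.submodule_eq, ← Projectivization.submodule_eq] at this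
    simpa using this
  have hf0 : f ≠ 0 := by
    intro h0
    apply hv
    ext i
    have := hf (Pi.single i 1)
    rw [h0] at this
    simpa using this.symm
  have hker : Module.finrank K (LinearMap.ker f) = 2 := by
    have h1 := LinearMap.finrank_range_add_finrank_ker f
    rw [LinearMap.range_eq_top.2 (LinearMap.surjective hf0)] at h1
    simp at h1
    omega
  have heq := Submodule.eq_of_le_of_finrank_eq hle (hfr.trans hker.symm)
  ext R
  rw [lineThrough, Set.mem_ofPred_eq, heq, hsub]

theorem exists_line_map (g : (Fin 3 → K) ≃ₗ[K] (Fin 3 → K)) {v : Fin 3 → K} (hv : v ≠ 0) :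
    ∃ v' ≠ 0, ∀ P, Projectivization.map g.toLinearMap g.injective P ∈ line v ↔ P ∈ line v' := by
  have hlin : ∀ w, (fun i => v ⬝ᵥ g (Pi.single i 1)) ⬝ᵥ w = v ⬝ᵥ g w := by
    intro w
    conv_rhs => rw [show w = ∑ i, w i • (Pi.single i (1 : K) : Fin 3 → K) by
      ext j; simp [Finset.sum_apply, Pi.single_apply]]
    rw [map_sum, dotProduct_sum]
    simp only [map_smul, dotProduct_smul, smul_eq_mul]
    rw [dotProduct]
    exact Finset.sum_congr rfl fun i _ => mul_comm _ _
  refine ⟨fun i => v ⬝ᵥ g (Pi.single i 1), ?_, ?_⟩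
  · intro h0
    apply hv
    ext i
    have := hlin (g.symm (Pi.single i 1))
    rw [h0] at this
    simpa using this.symm
  · intro P
    induction P using Projectivization.ind with
    | h w hw =>
      rw [Projectivization.map_mk, mk_mem_line, mk_mem_line, hlin]
      rfl

theorem map_bijective (g : (Fin 3 → K) ≃ₗ[K] (Fin 3 → K)) :
    Function.Bijective (Projectivization.map g.toLinearMap g.injective : Plane K → Plane K) := by
  refine ⟨Projectivization.map_injective _ _, fun P => ?_⟩
  induction P using Projectivization.ind with
  | h w hw =>
    refine ⟨Projectivization.mk K (g.symm w) (by simpa using hw), ?_⟩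
    rw [Projectivization.map_mk]
    congr 1
    simp

theorem map_mem_lineThrough (g : (Fin 3 → K) ≃ₗ[K] (Fin 3 → K)) {P Q R : Plane K} :
    Projectivization.map g.toLinearMap g.injective R ∈
      lineThrough (Projectivization.map g.toLinearMap g.injective P)
        (Projectivization.map g.toLinearMap g.injective Q) ↔ R ∈ lineThrough P Q := by
  have hsub : ∀ P : Plane K, (Projectivization.map g.toLinearMap g.injective P).submodule =
      P.submodule.map g.toLinearMap := by
    intro P
    induction P using Projectivization.ind with
    | h w hw =>
      rw [Projectivization.map_mk, Projectivization.submodule_mk, Projectivization.submodule_mk,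
        Submodule.map_span, Set.image_singleton]
  simp only [lineThrough, Set.mem_ofPred_eq, hsub]
  rw [← Submodule.map_sup, Submodule.map_le_map_iff_of_injective g.injective]

theorem ProjEquivalent.symm {U V : Set (Plane K)} (h : ProjEquivalent U V) :
    ProjEquivalent V U := by
  obtain ⟨g, rfl⟩ := h
  refine ⟨g.symm, ?_⟩
  rw [Set.image_image]
  convert Set.image_id V with P
  induction P using Projectivization.ind with
  | h w hw =>
    rw [Projectivization.map_mk, Projectivization.map_mk]
    simp

theorem ProjEquivalent.trans {U V W : Set (Plane K)} (h : ProjEquivalent U V)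
    (h' : ProjEquivalent V W) : ProjEquivalent U W := by
  obtain ⟨g, rfl⟩ := h
  obtain ⟨g', rfl⟩ := h'
  refine ⟨g'.trans g, ?_⟩
  rw [Set.image_image]
  congr 1
  funext P
  induction P using Projectivization.ind with
  | h w hw =>
    rw [Projectivization.map_mk, Projectivization.map_mk, Projectivization.map_mk]
    simp

theorem ProjEquivalent.nonempty_iso {U V : Set (Plane K)} (h : ProjEquivalent U V) :
    Nonempty (tangentGraph V ≃g tangentGraph U) := by
  obtain ⟨g, rfl⟩ := h
  have hb := map_bijective g
  let e : Plane K ≃ Plane K := Equiv.ofBijective _ hb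
  refine ⟨⟨e.subtypeEquiv fun P => not_congr (hb.1.mem_set_image).symm, ?_⟩⟩
  intro P Q
  refine and_congr ((Equiv.injective _).ne_iff) ?_
  exact hb.existsUnique_iff.trans
    (existsUnique_congr fun R => and_congr hb.1.mem_set_image (map_mem_lineThrough g))

/-- A unital: `q³ + 1` points such that each line meets it in `1` or `q + 1` points. -/
structure IsUnital (q : ℕ) (U : Set (Plane K)) : Prop where
  ncard : U.ncard = q ^ 3 + 1
  ncard_line : ∀ v ≠ 0, (U ∩ line v).ncard = 1 ∨ (U ∩ line v).ncard = q + 1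

theorem IsUnital.of_projEquivalent {q : ℕ} {U V : Set (Plane K)} (hV : IsUnital q V)
    (h : ProjEquivalent U V) : IsUnital q U := by
  obtain ⟨g, rfl⟩ := h
  have hb := map_bijective g
  refine ⟨by rw [Set.ncard_image_of_injective _ hb.1, hV.ncard], fun v hv => ?_⟩
  obtain ⟨v', hv', h⟩ := exists_line_map g hv
  have : Projectivization.map g.toLinearMap g.injective '' V ∩ line v =
      Projectivization.map g.toLinearMap g.injective '' (V ∩ line v') := by
    ext P
    obtain ⟨P, rfl⟩ := hb.2 P
    rw [Set.mem_inter_iff, hb.1.mem_set_image, hb.1.mem_set_image, h, Set.mem_inter_iff]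
  rw [this, Set.ncard_image_of_injective _ hb.1]
  exact hV.ncard_line v' hv'

end Lines

/-! ### Unitals, their tangents, and the resulting design. -/

section Unital

variable {K : Type*} [Field K]

/-- The tangent lines of a set of points, as points of the dual plane. -/
abbrev TangentLine (U : Set (Plane K)) : Type _ := {l : Plane K // (U ∩ line l.rep).ncard = 1}

/-- Incidence of points off `U` with tangent lines of `U`. -/
def tangentInc (U : Set (Plane K)) (P : {P : Plane K // P ∉ U}) (t : TangentLine U) : Prop :=
  P.1 ∈ line t.1.rep

theorem ncard_inter_eq_one_iff {U s : Set (Plane K)} :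
    (U ∩ s).ncard = 1 ↔ ∃! R, R ∈ U ∧ R ∈ s := by
  rw [Set.ncard_eq_one]
  constructor
  · rintro ⟨a, ha⟩
    exact ⟨a, ha.symm.subset rfl, fun b hb => ha.subset hb⟩
  · rintro ⟨a, ha, hu⟩
    exact ⟨a, Set.eq_singleton_iff_unique_mem.2 ⟨ha, fun b hb => hu b hb⟩⟩

/-- The roles are dual to those in the plane: the points off `U` are the blocks and the tangents are
the points of the incidence structure. -/
theorem tangentGraph_eq_blockGraph (U : Set (Plane K)) :
    tangentGraph U = blockGraph (tangentInc U) := by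
  ext P Q
  constructor
  · rintro ⟨h, hR⟩
    refine ⟨h, ?_⟩
    have h' : P.1 ≠ Q.1 := fun e => h (Subtype.ext e)
    obtain ⟨l, ⟨hP, hQ⟩, -⟩ := existsUnique_line h'
    rw [lineThrough_eq_line h' l.rep_nonzero hP hQ] at hR
    exact ⟨⟨l, ncard_inter_eq_one_iff.2 hR⟩, hP, hQ⟩
  · rintro ⟨h, t, hP, hQ⟩
    refine ⟨h, ?_⟩
    have h' : P.1 ≠ Q.1 := fun e => h (Subtype.ext e)
    rw [lineThrough_eq_line h' t.1.rep_nonzero hP hQ]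
    exact ncard_inter_eq_one_iff.1 t.2

variable [Finite K] {q : ℕ}

theorem order_plane (hK : Nat.card K = q ^ 2) :
    ∃ (_ : DecidableEq K), Configuration.ProjectivePlane.order (Plane K) (Plane K) = q ^ 2 := by
  classical
  have := Fintype.ofFinite (Plane K)
  refine ⟨inferInstance, ?_⟩
  have h := Configuration.ProjectivePlane.card_points (Plane K) (Plane K)
  have h' := Projectivization.card_of_finrank K (Fin 3 → K) (n := 3) (by simp)
  rw [Nat.card_eq_fintype_card, h, hK] at h'
  simp only [Finset.sum_range_succ, Finset.sum_range_zero, pow_zero, pow_one, zero_add] at h'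
  nlinarith

theorem natCard_plane (hK : Nat.card K = q ^ 2) : Nat.card (Plane K) = 1 + q ^ 2 + (q ^ 2) ^ 2 := by
  have h' := Projectivization.card_of_finrank K (Fin 3 → K) (n := 3) (by simp)
  rw [h', hK]
  simp [Finset.sum_range_succ]

theorem ncard_line_rep (hK : Nat.card K = q ^ 2) (l : Plane K) : (line l.rep).ncard = q ^ 2 + 1 := by
  obtain ⟨_, h⟩ := order_plane hK
  have h' := Configuration.ProjectivePlane.pointCount_eq (Plane K) l
  rw [h] at h'
  rw [← h', Configuration.pointCount, ← Nat.card_coe_set_eq]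
  refine Nat.card_congr (Equiv.subtypeEquivRight fun P => ?_)
  rw [Configuration.ofField.mem_iff, orthogonal_iff_mem_line]

theorem ncard_lines (hK : Nat.card K = q ^ 2) (P : Plane K) :
    {l : Plane K | P ∈ line l.rep}.ncard = q ^ 2 + 1 := by
  obtain ⟨_, h⟩ := order_plane hK
  have h' := Configuration.ProjectivePlane.lineCount_eq (Plane K) P
  rw [h] at h'
  rw [← h', Configuration.lineCount, ← Nat.card_coe_set_eq]
  refine Nat.card_congr (Equiv.subtypeEquivRight fun l => ?_)
  rw [Configuration.ofField.mem_iff, orthogonal_iff_mem_line]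
  rfl

open scoped Classical in
/-- The points of a set other than `P` are distributed over the lines through `P`. -/
theorem sum_ncard_lines [Fintype (Plane K)] (U : Finset (Plane K)) (P : Plane K) (hP : P ∉ U) :
    ∑ l ∈ Finset.univ.filter (fun l : Plane K => P ∈ line l.rep),
      (U.filter fun R => R ∈ line l.rep).card = U.card := by
  have h := Finset.sum_card_bipartiteAbove_eq_sum_card_bipartiteBelow
    (s := Finset.univ.filter fun l : Plane K => P ∈ line l.rep) (t := U)
    (fun l R => R ∈ line l.rep)
  simp only [Finset.bipartiteAbove, Finset.bipartiteBelow] at h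
  rw [h, Finset.card_eq_sum_ones]
  refine Finset.sum_congr rfl fun R hR => ?_
  have hPR : P ≠ R := by
    rintro rfl
    exact hP hR
  obtain ⟨l, hl, hu⟩ := existsUnique_line hPR
  rw [Finset.card_eq_one]
  refine ⟨l, ?_⟩
  ext l'
  simp only [Finset.mem_filter, Finset.mem_univ, true_and, Finset.mem_singleton]
  constructor
  · exact fun h => hu l' h
  · rintro rfl
    exact hl

open scoped Classical in
-- Among `q² + 1` lines with only the values `m` and `m + q`, the total determines how often `m`
-- occurs: each occurrence lowers the sum by `q`.
theorem card_filter_tangent (hK : Nat.card K = q ^ 2) [Fintype (Plane K)] (P : Plane K)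
    (f : Plane K → ℕ) (m : ℕ)
    (hf : ∀ l : Plane K, P ∈ line l.rep → f l = m ∨ f l = m + q) :
    ∑ l ∈ Finset.univ.filter (fun l : Plane K => P ∈ line l.rep), f l +
      q * (Finset.univ.filter (fun l : Plane K => P ∈ line l.rep ∧ f l = m)).card =
      (q ^ 2 + 1) * (m + q) := by
  have hcard : (Finset.univ.filter (fun l : Plane K => P ∈ line l.rep)).card = q ^ 2 + 1 := by
    rw [← ncard_lines hK P, Set.ncard_eq_toFinset_card']
    congr 1
    ext
    simp
  rw [← hcard, ← smul_eq_mul (Finset.card _), ← Finset.sum_const, ← Finset.filter_filter,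
    Finset.card_filter, Finset.mul_sum, ← Finset.sum_add_distrib]
  refine Finset.sum_congr rfl fun l hl => ?_
  rcases hf l (Finset.mem_filter.1 hl).2 with h | h
  · rw [if_pos h, h]
    ring
  · by_cases hm : f l = m
    · rw [if_pos hm, hm]
      ring
    · rw [if_neg hm, h]
      ring

/-- The lines through `P` partition `U`, and `(q² + 1)(q + 1) - (q³ + 1) = q (q + 1)`. -/
theorem IsUnital.ncard_tangent_of_not_mem {U : Set (Plane K)} (hU : IsUnital q U) (hq : 0 < q)
    (hK : Nat.card K = q ^ 2) {P : Plane K} (hP : P ∉ U) :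
    {l : Plane K | P ∈ line l.rep ∧ (U ∩ line l.rep).ncard = 1}.ncard = q + 1 := by
  classical
  have := Fintype.ofFinite (Plane K)
  have h := card_filter_tangent hK P (fun l => (U ∩ line l.rep).ncard) 1 fun l _ => by
    rw [add_comm 1 q]
    exact hU.ncard_line _ l.rep_nonzero
  have hs := sum_ncard_lines U.toFinset P (by simpa using hP)
  have h1 : ∀ l : Plane K, (U ∩ line l.rep).ncard =
      (U.toFinset.filter fun R => R ∈ line l.rep).card := by
    intro l
    rw [Set.ncard_eq_toFinset_card']
    congr 1
    ext
    simp
  have h2 : U.toFinset.card = q ^ 3 + 1 := by rw [← hU.ncard, Set.ncard_eq_toFinset_card']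
  simp only [h1] at h ⊢
  rw [hs, h2] at h
  have h3 : {l : Plane K | P ∈ line l.rep ∧
      (U.toFinset.filter fun R => R ∈ line l.rep).card = 1}.ncard =
      (Finset.univ.filter fun l : Plane K => P ∈ line l.rep ∧
        (U.toFinset.filter fun R => R ∈ line l.rep).card = 1).card := by
    rw [Set.ncard_eq_toFinset_card']
    congr 1
    ext
    simp
  rw [h3]
  apply Nat.eq_of_mul_eq_mul_left hq
  linarith

/-- The lines through `P` partition the other `q³` points of `U` into parts of size `0` or `q`, and
`(q² + 1) q - q³ = q`. -/
theorem IsUnital.ncard_tangent_of_mem {U : Set (Plane K)} (hU : IsUnital q U) (hq : 0 < q)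
    (hK : Nat.card K = q ^ 2) {P : Plane K} (hP : P ∈ U) :
    {l : Plane K | P ∈ line l.rep ∧ (U ∩ line l.rep).ncard = 1}.ncard = 1 := by
  classical
  have := Fintype.ofFinite (Plane K)
  have h1 : ∀ l : Plane K, P ∈ line l.rep → (U ∩ line l.rep).ncard =
      ((U.toFinset.erase P).filter fun R => R ∈ line l.rep).card + 1 := by
    intro l hl
    rw [Finset.filter_erase, Finset.card_erase_add_one (by simp [hP, hl]),
      Set.ncard_eq_toFinset_card']
    congr 1
    ext
    simp
  have h := card_filter_tangent hK P
    (fun l => ((U.toFinset.erase P).filter fun R => R ∈ line l.rep).card) 0 fun l hl => by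
      have := hU.ncard_line _ l.rep_nonzero
      rw [h1 l hl] at this
      omega
  have hs := sum_ncard_lines (U.toFinset.erase P) P (by simp)
  have h2 : U.toFinset.card = q ^ 3 + 1 := by rw [← hU.ncard, Set.ncard_eq_toFinset_card']
  rw [hs, Finset.card_erase_of_mem (by simpa using hP), h2] at h
  have h3 : {l : Plane K | P ∈ line l.rep ∧ (U ∩ line l.rep).ncard = 1}.ncard =
      (Finset.univ.filter fun l : Plane K => P ∈ line l.rep ∧
        ((U.toFinset.erase P).filter fun R => R ∈ line l.rep).card = 0).card := by
    rw [Set.ncard_eq_toFinset_card']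
    congr 1
    ext l
    simp only [Set.mem_toFinset, Set.mem_ofPred_eq, Finset.mem_filter, Finset.mem_univ, true_and]
    refine and_congr_right fun hl => ?_
    rw [h1 l hl]
    simp
  rw [h3]
  apply Nat.eq_of_mul_eq_mul_left hq
  rw [Nat.add_sub_cancel] at h
  linarith

/-- Two tangents meet in a point off `U`, because a point of `U` lies on only one tangent; that
point is the unique block on both. -/
theorem IsUnital.isDesign {U : Set (Plane K)} (hU : IsUnital q U) (hq : 0 < q)
    (hK : Nat.card K = q ^ 2) : IsDesign (tangentInc U) (q + 1) (q ^ 2) where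
  ncard_points P := by
    rw [← hU.ncard_tangent_of_not_mem hq hK P.2,
      ← Set.ncard_image_of_injective _ Subtype.val_injective]
    congr 1
    ext l
    constructor
    · rintro ⟨t, ht, rfl⟩
      exact ⟨ht, t.2⟩
    · rintro ⟨h, h'⟩
      exact ⟨⟨l, h'⟩, h, rfl⟩
  ncard_blocks t := by
    rw [← Set.ncard_image_of_injective _ Subtype.val_injective]
    have h : Subtype.val '' {P | tangentInc U P t} = line t.1.rep \ (U ∩ line t.1.rep) := by
      ext P
      constructor
      · rintro ⟨P, hP, rfl⟩
        exact ⟨hP, fun h => P.2 h.1⟩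
      · rintro ⟨h, h'⟩
        exact ⟨⟨P, fun hP => h' ⟨hP, h⟩⟩, h, rfl⟩
    rw [h, Set.ncard_sdiff Set.inter_subset_right, t.2, ncard_line_rep hK, Nat.add_sub_cancel]
  inter t t' h := by
    have h' : t.1 ≠ t'.1 := fun e => h (Subtype.ext e)
    obtain ⟨P, ⟨hP, hP'⟩, hu⟩ := existsUnique_point h'
    have hPU : P ∉ U := by
      intro hPU
      obtain ⟨l, hl⟩ := Set.ncard_eq_one.1 (hU.ncard_tangent_of_mem hq hK hPU)
      exact h' ((hl.subset ⟨hP, t.2⟩).trans (hl.subset ⟨hP', t'.2⟩).symm)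
    exact ⟨⟨P, hPU⟩, ⟨hP, hP'⟩, fun Q hQ => Subtype.ext (hu Q.1 hQ)⟩

theorem IsUnital.isSRG {U : Set (Plane K)} (hU : IsUnital q U) (hq : 0 < q)
    (hK : Nat.card K = q ^ 2) : IsSRG (tangentGraph U) (q ^ 2 * (q ^ 2 - q + 1))
      ((q + 1) * (q ^ 2 - 1)) (2 * (q ^ 2 - 1)) ((q + 1) ^ 2) := by
  classical
  have := Fintype.ofFinite (TangentLine U)
  have hqq : q ≤ q ^ 2 := Nat.le_self_pow two_ne_zero q
  obtain ⟨d, hd⟩ := Nat.exists_eq_add_of_le hqq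
  letI : Fintype {P : Plane K // P ∉ U} := Fintype.ofFinite _
  have hcard : Fintype.card {P : Plane K // P ∉ U} = q ^ 2 * (q ^ 2 - q + 1) := by
    rw [← Nat.card_eq_fintype_card]
    have h1 : Nat.card {P : Plane K // P ∉ U} = (Uᶜ : Set (Plane K)).ncard :=
      Nat.card_coe_set_eq _
    have h2 := Set.ncard_add_ncard_compl U
    rw [hU.ncard, natCard_plane hK] at h2
    rw [h1, hd, Nat.add_sub_cancel_left]
    nlinarith
  have h := (hU.isDesign hq hK).isSRGWith hcard
  rw [IsSRG]
  simp only [tangentGraph_eq_blockGraph]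
  have e1 : q ^ 2 - 1 - 1 + (q + 1 - 1) * (q + 1 - 1) = 2 * (q ^ 2 - 1) := by
    rw [Nat.add_sub_cancel, ← sq]
    have : q ^ 2 ≠ 1 := by
      intro h
      have h3 := Finite.one_lt_card (α := K)
      omega
    have h4 : 0 < q ^ 2 := by positivity
    omega
  rw [e1, ← sq (q + 1)] at h
  convert h

end Unital

/-! ### Affine coordinates. -/

section Affine

variable {K : Type*} [Field K]

theorem affinePoint_mem_line {x y : K} {v : Fin 3 → K} :
    affinePoint x y ∈ line v ↔ v 0 * x + v 1 * y + v 2 = 0 := by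
  rw [affinePoint, mk_mem_line]
  simp [dotProduct, Fin.sum_univ_three]

theorem infinitePoint_mem_line {v : Fin 3 → K} : infinitePoint K ∈ line v ↔ v 1 = 0 := by
  rw [infinitePoint, mk_mem_line]
  simp [dotProduct, Fin.sum_univ_three]

theorem affinePoint_inj {x y x' y' : K} : affinePoint x y = affinePoint x' y' ↔ x = x' ∧ y = y' := by
  constructor
  · intro h
    rw [affinePoint, affinePoint, Projectivization.mk_eq_mk_iff'] at h
    obtain ⟨a, ha⟩ := h
    have h0 := congrFun ha 0
    have h1 := congrFun ha 1
    have h2 := congrFun ha 2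
    simp at h0 h1 h2
    rw [h2, one_mul] at h0 h1
    exact ⟨h0.symm, h1.symm⟩
  · rintro ⟨rfl, rfl⟩
    rfl

theorem affinePoint_ne_infinitePoint (x y : K) : affinePoint x y ≠ infinitePoint K := by
  intro h
  have h1 : affinePoint x y ∈ line (![0, 0, 1] : Fin 3 → K) := by
    rw [h, infinitePoint_mem_line]
    simp
  rw [affinePoint_mem_line] at h1
  simp at h1

end Affine

/-! ### Ovoidal point sets are unitals. -/

section OvoidSet

variable {F K : Type*} [Field F] [Field K] [Algebra F K]

/-- The point set `{(x, y, 1) : τ y = φ x} ∪ {(0, 1, 0)}`. -/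
def ovoidSet (τ : K →ₗ[F] F) (φ : K → F) : Set (Plane K) :=
  {P | ∃ x y : K, P = affinePoint x y ∧ τ y = φ x} ∪ {infinitePoint K}

theorem affinePoint_mem_ovoidSet {τ : K →ₗ[F] F} {φ : K → F} {x y : K} :
    affinePoint x y ∈ ovoidSet τ φ ↔ τ y = φ x := by
  constructor
  · rintro (⟨x', y', h, h'⟩ | h)
    · obtain ⟨rfl, rfl⟩ := affinePoint_inj.1 h
      exact h'
    · exact absurd h (affinePoint_ne_infinitePoint x y)
  · intro h
    exact Or.inl ⟨x, y, rfl, h⟩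

theorem infinitePoint_mem_ovoidSet {τ : K →ₗ[F] F} {φ : K → F} :
    infinitePoint K ∈ ovoidSet τ φ := Or.inr rfl

variable [Finite F] [Finite K]

theorem bmSet_eq_ovoidSet {τ : K →ₗ[F] F} (hτ : IsCoord τ) (α β : K) :
    bmSet F α β = ovoidSet τ fun x => τ (α * x ^ 2 + β * (x * conj F x)) := by
  unfold bmSet ovoidSet
  congr 1
  ext P
  simp only [Set.mem_ofPred_eq, pow_card_add_one]
  constructor
  · rintro ⟨x, z, rfl⟩
    refine ⟨x, _, rfl, ?_⟩
    rw [map_add, (hτ _).2 ⟨z, rfl⟩, add_zero]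
  · rintro ⟨x, y, rfl, h⟩
    obtain ⟨z, hz⟩ := (hτ (y - (α * x ^ 2 + β * (x * conj F x)))).1
      (by rw [map_sub, h, sub_self])
    exact ⟨x, z, by rw [hz]; congr 1; ring⟩

theorem btSet_eq_ovoidSet {τ : K →ₗ[F] F} (hτ : IsCoord τ) {β : K} (hβ : τ β = 1)
    (hrep : ∀ w, ∃ x : F, w = algebraMap F K x + algebraMap F K (τ w) * β) {δ : ℕ} {φ : K → F}
    (hφ : ∀ x y, φ (algebraMap F K x + algebraMap F K y * β) = x ^ (δ + 2) + x * y + y ^ δ) :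
    btSet F δ β = ovoidSet τ φ := by
  unfold btSet ovoidSet
  congr 1
  ext P
  simp only [Set.mem_ofPred_eq]
  constructor
  · rintro ⟨x₀, x₁, z, rfl⟩
    refine ⟨_, _, rfl, ?_⟩
    rw [hφ, map_add, (hτ _).2 ⟨z, rfl⟩, add_zero, map_algebraMap_mul, hβ, mul_one]
  · rintro ⟨x, y, rfl, h⟩
    obtain ⟨x₀, hx₀⟩ := hrep x
    obtain ⟨z, hz⟩ := hrep y
    refine ⟨x₀, τ x, z, ?_⟩
    rw [← hφ, ← hx₀, ← h, add_comm _ (algebraMap F K z), ← hz]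

/-- A line missing `(0, 1, 0)` is `y = m x + b` with `m = -v 0 / v 1` and `b = -v 2 / v 1`;
projecting to `x` turns its section into a solution set counted by `OvoidData`. -/
theorem OvoidData.ncard_inter_line {τ : K →ₗ[F] F} {φ G : K → F} (h : OvoidData τ φ G)
    {v : Fin 3 → K} (hv : v 1 ≠ 0) :
    (τ (-v 2 / v 1) = G (-v 0 / v 1) → (ovoidSet τ φ ∩ line v).ncard = 1) ∧
    (τ (-v 2 / v 1) ≠ G (-v 0 / v 1) → (ovoidSet τ φ ∩ line v).ncard = Nat.card F + 1) := by
  have himg : ovoidSet τ φ ∩ line v = (fun x => affinePoint x (-v 0 / v 1 * x + -v 2 / v 1)) ''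
      {x | φ x = τ (-v 0 / v 1 * x) + τ (-v 2 / v 1)} := by
    ext P
    constructor
    · rintro ⟨⟨x, y, rfl, hxy⟩ | hP, hl⟩
      · rw [affinePoint_mem_line] at hl
        have hy : y = -v 0 / v 1 * x + -v 2 / v 1 := by
          field_simp
          linear_combination hl
        refine ⟨x, ?_, by rw [hy]⟩
        rw [Set.mem_ofPred_eq, ← hxy, hy, map_add]
      · rw [Set.mem_singleton_iff.1 hP, infinitePoint_mem_line] at hl
        exact absurd hl hv
    · rintro ⟨x, hx, rfl⟩
      refine ⟨affinePoint_mem_ovoidSet.2 ?_, affinePoint_mem_line.2 ?_⟩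
      · rw [map_add]
        exact hx.symm
      · field_simp
        ring
  have hinj : Function.Injective fun x => affinePoint x (-v 0 / v 1 * x + -v 2 / v 1) :=
    fun x x' h => (affinePoint_inj.1 h).1
  rw [himg, Set.ncard_image_of_injective _ hinj]
  constructor
  · intro hG
    rw [hG]
    obtain ⟨x, hx, hu⟩ := h.unique (-v 0 / v 1)
    rw [Set.ncard_eq_one]
    exact ⟨x, Set.eq_singleton_iff_unique_mem.2 ⟨hx, hu⟩⟩
  · exact h.ncard _ _

theorem OvoidData.isUnital {τ : K →ₗ[F] F} {φ G : K → F} (h : OvoidData τ φ G)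
    (hFK : Module.finrank F K = 2) {β : K} (hβ : τ β = 1) :
    IsUnital (Nat.card F) (ovoidSet τ φ) := by
  have hrep : ∀ (c : F) (y : K), τ y = c ↔ ∃ z : F, algebraMap F K z + algebraMap F K c * β = y := by
    intro c y
    constructor
    · rintro rfl
      obtain ⟨z, hz⟩ := (h.coord (y - algebraMap F K (τ y) * β)).1
        (by rw [map_sub, map_algebraMap_mul, hβ, mul_one, sub_self])
      exact ⟨z, by rw [hz]; ring⟩
    · rintro ⟨z, rfl⟩
      rw [map_add, h.coord.map_algebraMap, map_algebraMap_mul, hβ, mul_one, zero_add]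
  have hF := Finite.card_pos (α := F)
  refine ⟨?_, fun v hv => ?_⟩
  · have himg : ovoidSet τ φ = insert (infinitePoint K) (Set.range fun p : K × F =>
        affinePoint p.1 (algebraMap F K p.2 + algebraMap F K (φ p.1) * β)) := by
      rw [ovoidSet, Set.union_comm, Set.singleton_union]
      congr 1
      ext P
      constructor
      · rintro ⟨x, y, rfl, hxy⟩
        obtain ⟨z, rfl⟩ := (hrep _ _).1 hxy
        exact ⟨(x, z), rfl⟩
      · rintro ⟨⟨x, z⟩, rfl⟩
        exact ⟨x, _, rfl, (hrep _ _).2 ⟨z, rfl⟩⟩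
    have hinj : Function.Injective fun p : K × F =>
        affinePoint p.1 (algebraMap F K p.2 + algebraMap F K (φ p.1) * β) := by
      rintro ⟨x, z⟩ ⟨x', z'⟩ hp
      obtain ⟨h1, h2⟩ := affinePoint_inj.1 hp
      simp only at h1 h2
      subst h1
      rw [(algebraMap F K).injective (add_right_cancel h2)]
    rw [himg, Set.ncard_insert_of_notMem, ← Set.image_univ, Set.ncard_image_of_injective _ hinj,
      Set.ncard_univ, Nat.card_prod, natCard_eq_sq hFK]
    · ring
    · rintro ⟨p, hp⟩
      exact affinePoint_ne_infinitePoint _ _ hp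
  · by_cases hv1 : v 1 = 0
    · by_cases hv0 : v 0 = 0
      · left
        rw [Set.ncard_eq_one]
        refine ⟨infinitePoint K, Set.eq_singleton_iff_unique_mem.2
          ⟨⟨infinitePoint_mem_ovoidSet, infinitePoint_mem_line.2 hv1⟩, ?_⟩⟩
        rintro P ⟨⟨x, y, rfl, -⟩ | hP, hl⟩
        · rw [affinePoint_mem_line, hv0, hv1, zero_mul, zero_mul, zero_add, zero_add] at hl
          exfalso
          apply hv
          ext i
          fin_cases i
          exacts [hv0, hv1, hl]
        · exact hP
      · right
        have himg : ovoidSet τ φ ∩ line v = insert (infinitePoint K) (Set.range fun z : F =>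
            affinePoint (-v 2 / v 0)
              (algebraMap F K z + algebraMap F K (φ (-v 2 / v 0)) * β)) := by
          ext P
          constructor
          · rintro ⟨⟨x, y, rfl, hxy⟩ | hP, hl⟩
            · rw [affinePoint_mem_line, hv1] at hl
              have hx : x = -v 2 / v 0 := by
                field_simp
                linear_combination hl
              obtain ⟨z, rfl⟩ := (hrep _ _).1 hxy
              exact Or.inr ⟨z, by rw [hx]⟩
            · exact Or.inl hP
          · rintro (hP | ⟨z, rfl⟩)
            · rw [hP]
              exact ⟨infinitePoint_mem_ovoidSet, infinitePoint_mem_line.2 hv1⟩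
            · refine ⟨affinePoint_mem_ovoidSet.2 ((hrep _ _).2 ⟨z, rfl⟩),
                affinePoint_mem_line.2 ?_⟩
              rw [hv1]
              field_simp
              ring
        have hinj : Function.Injective fun z : F => affinePoint (-v 2 / v 0)
              (algebraMap F K z + algebraMap F K (φ (-v 2 / v 0)) * β) := by
          intro z z' hz
          exact (algebraMap F K).injective (add_right_cancel (affinePoint_inj.1 hz).2)
        rw [himg, Set.ncard_insert_of_notMem, ← Set.image_univ,
          Set.ncard_image_of_injective _ hinj, Set.ncard_univ]
        rintro ⟨p, hp⟩
        exact affinePoint_ne_infinitePoint _ _ hp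
    · by_cases hG : τ (-v 2 / v 1) = G (-v 0 / v 1)
      · exact Or.inl ((h.ncard_inter_line hv1).1 hG)
      · exact Or.inr ((h.ncard_inter_line hv1).2 hG)

end OvoidSet

/-! ### Quadrangles of tangents in the plane. -/

section Quadrangle

variable {K : Type*} [Field K]

theorem line_eq_line {P Q : Plane K} (h : P ≠ Q) {v w : Fin 3 → K} (hv : v ≠ 0) (hw : w ≠ 0)
    (hPv : P ∈ line v) (hQv : Q ∈ line v) (hPw : P ∈ line w) (hQw : Q ∈ line w) :
    line v = line w := by
  rw [← lineThrough_eq_line h hv hPv hQv, lineThrough_eq_line h hw hPw hQw]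

variable [Finite K] {q : ℕ}

theorem IsUnital.not_mem_of_tangents {U : Set (Plane K)} (hU : IsUnital q U) (hq : 0 < q)
    (hK : Nat.card K = q ^ 2) {P Q : Plane K} {v w : Fin 3 → K} (hv : v ≠ 0) (hw : w ≠ 0)
    (hv1 : (U ∩ line v).ncard = 1) (hw1 : (U ∩ line w).ncard = 1) (hPv : P ∈ line v)
    (hPw : P ∈ line w) (hQv : Q ∈ line v) (hQw : Q ∉ line w) : P ∉ U := by
  intro hP
  obtain ⟨l, hl⟩ := Set.ncard_eq_one.1 (hU.ncard_tangent_of_mem hq hK hP)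
  have h1 : Projectivization.mk K v hv = l :=
    hl.subset ⟨by rwa [line_rep_mk], by rwa [line_rep_mk]⟩
  have h2 : Projectivization.mk K w hw = l :=
    hl.subset ⟨by rwa [line_rep_mk], by rwa [line_rep_mk]⟩
  rw [← line_rep_mk hw, h2, ← h1, line_rep_mk] at hQw
  exact hQw hQv

/-- That the four points avoid `U` need not be assumed: each lies on two different tangents, and a
point of `U` lies on only one. -/
theorem IsUnital.exists_isQuadrangle {U : Set (Plane K)} (hU : IsUnital q U) (hq : 0 < q)
    (hK : Nat.card K = q ^ 2) (P : Fin 4 → Plane K)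
    (h : ∀ i j, i < j → ∃ v ≠ 0, (U ∩ line v).ncard = 1 ∧ P i ∈ line v ∧ P j ∈ line v ∧
      ∀ k, k ≠ i → k ≠ j → P k ∉ line v) :
    ∃ v w x y, IsQuadrangle (tangentInc U) v w x y := by
  have h' : ∀ i j, i ≠ j → ∃ v ≠ 0, (U ∩ line v).ncard = 1 ∧ P i ∈ line v ∧ P j ∈ line v ∧
      ∀ k, k ≠ i → k ≠ j → P k ∉ line v := by
    intro i j hij
    rcases lt_or_gt_of_ne hij with hlt | hlt
    · exact h i j hlt
    · obtain ⟨v, hv, h1, h2, h3, h4⟩ := h j i hlt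
      exact ⟨v, hv, h1, h3, h2, fun k hk hk' => h4 k hk' hk⟩
  have hex : ∀ i j : Fin 4, ∃ k, k ≠ i ∧ k ≠ j := by decide
  have hne : ∀ i j, i ≠ j → P i ≠ P j := by
    intro i j hij e
    obtain ⟨k, hki, hkj⟩ := hex i j
    obtain ⟨v, -, -, hi, -, hn⟩ := h' i k hki.symm
    exact hn j hij.symm hkj.symm (e ▸ hi)
  have hPU : ∀ i, P i ∉ U := by
    intro i
    obtain ⟨j, hj, -⟩ := hex i i
    obtain ⟨k, hki, hkj⟩ := hex i j
    obtain ⟨v, hv, hv1, hi, hjv, hn⟩ := h' i j hj.symm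
    obtain ⟨w, hw, hw1, hiw, hkw, hnw⟩ := h' i k hki.symm
    exact hU.not_mem_of_tangents hq hK hv hw hv1 hw1 hi hiw hjv (hnw j hj hkj.symm)
  have hadj : ∀ i j, i ≠ j →
      (blockGraph (tangentInc U)).Adj ⟨P i, hPU i⟩ ⟨P j, hPU j⟩ := by
    intro i j hij
    obtain ⟨v, hv, hv1, hi, hj, -⟩ := h' i j hij
    refine ⟨fun e => hne i j hij (congrArg Subtype.val e),
      ⟨Projectivization.mk K v hv, by rwa [line_rep_mk]⟩, ?_, ?_⟩ <;>
    · rw [tangentInc, line_rep_mk]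
      assumption
  have hno : ∀ i j k, i ≠ j → k ≠ i → k ≠ j → ∀ t, tangentInc U ⟨P i, hPU i⟩ t →
      tangentInc U ⟨P j, hPU j⟩ t → ¬ tangentInc U ⟨P k, hPU k⟩ t := by
    intro i j k hij hki hkj t hi hj hk
    obtain ⟨v, hv, -, hiv, hjv, hn⟩ := h' i j hij
    apply hn k hki hkj
    rw [line_eq_line (hne i j hij) hv t.1.rep_nonzero hiv hjv hi hj]
    exact hk
  refine ⟨⟨P 0, hPU 0⟩, ⟨P 1, hPU 1⟩, ⟨P 2, hPU 2⟩, ⟨P 3, hPU 3⟩, ?_, ?_, ?_, ?_, ?_, ?_, ?_, ?_,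
    ?_, ?_⟩
  all_goals first
    | exact hadj _ _ (by decide)
    | exact hno _ _ _ (by decide) (by decide) (by decide)

end Quadrangle

/-! ### Absence of quadrangles makes the dual function a multiple of the norm. -/

section OvoidQuadrangle

variable {F K : Type*} [Field F] [Field K] [Finite F] [Finite K] [Algebra F K]

/-- Three tangent lines `x = nᵢ y + cᵢ`, whose points of intersection have distinct `y`-coordinates
in `F`, form a quadrangle with the point `(1, 0, 0)`. -/
theorem OvoidData.exists_isQuadrangle_of_lines {τ : K →ₗ[F] F} {φ G : K → F}
    (h : OvoidData τ φ G) (hFK : Module.finrank F K = 2) {β : K} (hβ : τ β = 1)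
    {n₁ n₂ n₃ c₁ c₂ c₃ : K} {y₁₂ y₁₃ y₂₃ : F} (hn₁ : n₁ ≠ 0) (hn₂ : n₂ ≠ 0) (hn₃ : n₃ ≠ 0)
    (hn₁₂ : n₁ ≠ n₂) (hn₁₃ : n₁ ≠ n₃) (h₁ : y₁₂ ≠ y₁₃) (h₂ : y₁₂ ≠ y₂₃)
    (h₃ : y₁₃ ≠ y₂₃)
    (h₁₂ : n₁ * algebraMap F K y₁₂ + c₁ = n₂ * algebraMap F K y₁₂ + c₂)
    (h₁₃ : n₁ * algebraMap F K y₁₃ + c₁ = n₃ * algebraMap F K y₁₃ + c₃)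
    (h₂₃ : n₂ * algebraMap F K y₂₃ + c₂ = n₃ * algebraMap F K y₂₃ + c₃)
    (ht₁ : τ (-c₁ / n₁) = G n₁⁻¹) (ht₂ : τ (-c₂ / n₂) = G n₂⁻¹) (ht₃ : τ (-c₃ / n₃) = G n₃⁻¹) :
    ∃ v w x y, IsQuadrangle (tangentInc (ovoidSet τ φ)) v w x y := by
  have hinj : ∀ {a b : F}, a ≠ b → algebraMap F K a ≠ algebraMap F K b :=
    fun hab e => hab ((algebraMap F K).injective e)
  obtain ⟨P₀, hP₀⟩ : ∃ P₀ : Plane K, ∀ v, P₀ ∈ line v ↔ v 0 = 0 := by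
    refine ⟨Projectivization.mk K ![1, 0, 0] fun h => one_ne_zero (congrFun h 0), fun v => ?_⟩
    rw [mk_mem_line]
    simp [dotProduct, Fin.sum_univ_three]
  -- The horizontal lines `Y = y` with `y ∈ F` pass through `(1, 0, 0)` and are tangent, since `G 0
  -- = 0` and `τ` vanishes on `F`. They supply three of the six joining lines.
  have hhor : ∀ y : F, (ovoidSet τ φ ∩ line ![0, 1, -algebraMap F K y]).ncard = 1 := by
    intro y
    refine (h.ncard_inter_line (by simp)).1 ?_
    simp [(h.zero 0).2 rfl, h.coord.map_algebraMap]
  have hobl : ∀ {n c : K}, n ≠ 0 → τ (-c / n) = G n⁻¹ →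
      (ovoidSet τ φ ∩ line ![1, -n, -c]).ncard = 1 := by
    intro n c hn ht
    refine (h.ncard_inter_line (by simpa using hn)).1 ?_
    simp only [Matrix.cons_val_zero, Matrix.cons_val_one, Matrix.cons_val]
    rw [neg_div_neg_eq, neg_div_neg_eq, one_div, ht]
  refine (h.isUnital hFK hβ).exists_isQuadrangle Finite.card_pos (natCard_eq_sq hFK)
    ![P₀, affinePoint (n₁ * algebraMap F K y₁₂ + c₁) (algebraMap F K y₁₂),
      affinePoint (n₁ * algebraMap F K y₁₃ + c₁) (algebraMap F K y₁₃),
      affinePoint (n₂ * algebraMap F K y₂₃ + c₂) (algebraMap F K y₂₃)] ?_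
  have hhor' : ∀ y : F, (![0, 1, -algebraMap F K y] : Fin 3 → K) ≠ 0 :=
    fun y e => one_ne_zero (congrFun e 1)
  have hobl' : ∀ n c : K, (![1, -n, -c] : Fin 3 → K) ≠ 0 :=
    fun n c e => one_ne_zero (congrFun e 0)
  have hneq : ∀ {n m c d : K} {y z : F}, n ≠ m → y ≠ z →
      n * algebraMap F K y + c = m * algebraMap F K y + d →
      n * algebraMap F K z + c ≠ m * algebraMap F K z + d := by
    intro n m c d y z hnm hyz h e
    have : (n - m) * (algebraMap F K y - algebraMap F K z) = 0 := by linear_combination h - e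
    exact (mul_ne_zero (sub_ne_zero.2 hnm) (sub_ne_zero.2 (hinj hyz))) this
  have mem_hor : ∀ {x : K} {y z : F},
      affinePoint x (algebraMap F K y) ∈ line ![0, 1, -algebraMap F K z] ↔ y = z := by
    intro x y z
    rw [affinePoint_mem_line, ← (algebraMap F K).injective.eq_iff (a := y)]
    simp [← sub_eq_add_neg, sub_eq_zero]
  have mem_obl : ∀ {x y n c : K}, affinePoint x y ∈ line ![1, -n, -c] ↔ x = n * y + c := by
    intro x y n c
    rw [affinePoint_mem_line, ← sub_eq_zero (a := x)]
    simp only [Matrix.cons_val_zero, Matrix.cons_val_one, Matrix.cons_val]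
    constructor <;> intro h <;> linear_combination h
  have hP₀h : ∀ z : F, P₀ ∈ line ![0, 1, -algebraMap F K z] := fun z => (hP₀ _).2 rfl
  have hP₀o : ∀ n c : K, P₀ ∉ line ![1, -n, -c] := fun n c e => one_ne_zero ((hP₀ _).1 e)
  intro i j hij
  fin_cases i <;> fin_cases j <;> try exact absurd hij (by decide)
  · refine ⟨_, hhor' y₁₂, hhor y₁₂, hP₀h _, mem_hor.2 rfl, fun k hki hkj => ?_⟩
    fin_cases k
    exacts [absurd rfl hki, absurd rfl hkj, mt mem_hor.1 h₁.symm, mt mem_hor.1 h₂.symm]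
  · refine ⟨_, hhor' y₁₃, hhor y₁₃, hP₀h _, mem_hor.2 rfl, fun k hki hkj => ?_⟩
    fin_cases k
    exacts [absurd rfl hki, mt mem_hor.1 h₁, absurd rfl hkj, mt mem_hor.1 h₃.symm]
  · refine ⟨_, hhor' y₂₃, hhor y₂₃, hP₀h _, mem_hor.2 rfl, fun k hki hkj => ?_⟩
    fin_cases k
    exacts [absurd rfl hki, mt mem_hor.1 h₂, mt mem_hor.1 h₃, absurd rfl hkj]
  · refine ⟨_, hobl' n₁ c₁, hobl hn₁ ht₁, mem_obl.2 rfl, mem_obl.2 rfl, fun k hki hkj => ?_⟩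
    fin_cases k
    exacts [hP₀o _ _, absurd rfl hki, absurd rfl hkj, mt mem_obl.1 (hneq hn₁₂ h₂ h₁₂).symm]
  · refine ⟨_, hobl' n₂ c₂, hobl hn₂ ht₂, mem_obl.2 h₁₂, mem_obl.2 rfl, fun k hki hkj => ?_⟩
    fin_cases k
    exacts [hP₀o _ _, absurd rfl hki, mt mem_obl.1 (hneq hn₁₂ h₁ h₁₂), absurd rfl hkj]
  · refine ⟨_, hobl' n₃ c₃, hobl hn₃ ht₃, mem_obl.2 h₁₃, mem_obl.2 h₂₃, fun k hki hkj => ?_⟩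
    fin_cases k
    exacts [hP₀o _ _, mt mem_obl.1 (hneq hn₁₃ h₁.symm h₁₃), absurd rfl hki, absurd rfl hkj]

/-- The dual function of an ovoidal Buekenhout-Metz unital without quadrangles of tangent lines is a
multiple of the norm. -/
theorem OvoidData.eq_norm_of_forall_not_isQuadrangle {τ : K →ₗ[F] F} {φ G : K → F}
    (h : OvoidData τ φ G) (hFK : Module.finrank F K = 2) {β : K} (hβ : τ β = 1)
    (hno : ¬ ∃ v w x y, IsQuadrangle (tangentInc (ovoidSet τ φ)) v w x y) :
    ∃ k : K, ∀ m, algebraMap F K (G m) = k * (m * conj F m) := by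
  choose ν hν using exists_mul_conj (F := F) (K := K) hFK
  have hν0 : ∀ n, n ≠ 0 → ν n ≠ 0 := by
    intro n hn e
    have := hν n
    rw [e, map_zero] at this
    exact mul_ne_zero hn (mt conj_eq_zero.1 hn) this.symm
  -- With this normalisation the tangency of `x = n y + c` reads `τ (c * conj F n) = g n`, and the
  -- goal becomes that `g` is constant on nonzero elements.
  obtain ⟨g, hg⟩ : ∃ g : K → F, g = fun n => -(ν n * G n⁻¹) := ⟨_, rfl⟩
  have hg0 : ∀ n, n ≠ 0 → g n ≠ 0 := by
    intro n hn
    rw [hg]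
    exact neg_ne_zero.2 (mul_ne_zero (hν0 n hn) (mt (h.zero _).1 (inv_ne_zero hn)))
  have htan : ∀ n c, n ≠ 0 → τ (c * conj F n) = g n → τ (-c / n) = G n⁻¹ := by
    intro n c hn e
    have h1 : c * conj F n = algebraMap F K (ν n) * (c / n) := by
      rw [hν]
      field_simp
    rw [h1, map_algebraMap_mul, hg] at e
    apply mul_left_cancel₀ (hν0 n hn)
    rw [neg_div, map_neg]
    linear_combination -e
  -- `(n, m) ↦ τ (n * conj F m)` is an alternating `F`-bilinear form on the plane `K`; `hform` is
  -- its determinant formula.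
  have hskew : ∀ n m, τ (n * conj F m) = -τ (m * conj F n) := by
    intro n m
    rw [← h.coord.map_conj hFK, map_mul (conj F), conj_conj hFK, mul_comm]
  have hself : ∀ n, τ (n * conj F n) = 0 := fun n => (h.coord _).2 ⟨ν n, hν n⟩
  have hform : ∀ (n m : K) (a b p r : F), τ ((algebraMap F K a * n + algebraMap F K b * m) *
      conj F (algebraMap F K p * n + algebraMap F K r * m)) =
        (a * r - b * p) * τ (n * conj F m) := by
    intro n m a b p r
    simp only [map_add (conj F), map_mul (conj F), AlgHom.commutes]
    have h1 : (algebraMap F K a * n + algebraMap F K b * m) *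
        (algebraMap F K p * conj F n + algebraMap F K r * conj F m) =
        algebraMap F K (a * p) * (n * conj F n) + algebraMap F K (a * r) * (n * conj F m) +
        algebraMap F K (b * p) * (m * conj F n) + algebraMap F K (b * r) * (m * conj F m) := by
      simp only [map_mul]
      ring
    rw [h1]
    simp only [map_add, map_algebraMap_mul, hself]
    rw [hskew m n]
    ring
  -- If `n`, `m` are independent for the alternating form and `g n ≠ g m`, three tangents can be
  -- written down that complete to a forbidden quadrangle.
  have hind : ∀ n m, τ (n * conj F m) ≠ 0 → g n = g m := by
    intro n m hθ
    by_contra hgne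
    have hn : n ≠ 0 := by
      rintro rfl
      simp at hθ
    have hm : m ≠ 0 := by
      rintro rfl
      simp at hθ
    have hnm : n ≠ m := by
      rintro rfl
      exact hθ (hself n)
    obtain ⟨θ, hθe⟩ : ∃ θ, θ = τ (n * conj F m) := ⟨_, rfl⟩
    rw [← hθe] at hθ
    have hd : g m - g n ≠ 0 := sub_ne_zero.2 (Ne.symm hgne)
    -- The weights satisfy `p + r = 1` and `p * g n + r * g m = 0`; solving for them uses `g n ≠ g
    -- m`.
    obtain ⟨p, hp⟩ : ∃ p, p = g m / (g m - g n) := ⟨_, rfl⟩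
    obtain ⟨r, hr⟩ : ∃ r, r = -g n / (g m - g n) := ⟨_, rfl⟩
    have hp0 : p ≠ 0 := hp ▸ div_ne_zero (hg0 m hm) hd
    have hr0 : r ≠ 0 := hr ▸ div_ne_zero (neg_ne_zero.2 (hg0 n hn)) hd
    have hpr : p + r = 1 := by
      rw [hp, hr]
      field_simp
      ring
    have hprg : p * g n + r * g m = 0 := by
      rw [hp, hr]
      field_simp
      ring
    obtain ⟨n₃, hn₃⟩ : ∃ n₃, n₃ = algebraMap F K p * n + algebraMap F K r * m := ⟨_, rfl⟩
    have hn₃0 : n₃ ≠ 0 := by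
      intro e
      have h1 := hform n m 1 0 p r
      rw [← hn₃, e, map_zero (conj F), mul_zero, map_zero τ, ← hθe] at h1
      rw [one_mul, zero_mul, sub_zero] at h1
      exact mul_ne_zero hr0 hθ h1.symm
    have hprK : algebraMap F K p + algebraMap F K r = 1 := by rw [← map_add, hpr, map_one]
    have hpK : algebraMap F K p ≠ 0 := (map_ne_zero _).2 hp0
    have hrK : algebraMap F K r ≠ 0 := (map_ne_zero _).2 hr0
    have hn₃n : n - n₃ = algebraMap F K r * (n - m) := by
      rw [hn₃]
      linear_combination -n * hprK
    have hn₃m : m - n₃ = -(algebraMap F K p * (n - m)) := by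
      rw [hn₃]
      linear_combination -m * hprK
    have hnm0 := sub_ne_zero.2 hnm
    -- The third line will be `p` times the first plus `r` times the second, displaced by `ε (n -
    -- m)`. Its tangency condition reduces to `p g(n) + r g(m) + ε θ = g(n₃)`, so the choice of
    -- weights makes `ε` nonzero and the lines not concurrent.
    obtain ⟨ε, hε⟩ : ∃ ε, ε = g n₃ / θ := ⟨_, rfl⟩
    have hε0 : ε ≠ 0 := hε ▸ div_ne_zero (hg0 _ hn₃0) hθ
    -- `c₁` and `c₂` satisfy the two tangency conditions and differ by an `F`-multiple of `n - m`,
    -- as does `c₃` from each of them; this puts the three intersection heights in `F`.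
    refine hno (h.exists_isQuadrangle_of_lines hFK hβ (n₁ := n) (n₂ := m) (n₃ := n₃)
      (c₁ := algebraMap F K 0 * n + algebraMap F K (-(g n / θ)) * m)
      (c₂ := algebraMap F K (g m / θ) * n + algebraMap F K (-((g n + g m) / θ)) * m)
      (c₃ := algebraMap F K (r * (g m / θ) + ε) * n +
        algebraMap F K (-(p * (g n / θ)) - r * ((g n + g m) / θ) - ε) * m)
      (y₁₂ := g m / θ) (y₁₃ := g m / θ + ε / r) (y₂₃ := g m / θ - ε / p)
      hn hm hn₃0 hnm ?_ ?_ ?_ ?_ ?_ ?_ ?_ (htan _ _ hn ?_) (htan _ _ hm ?_) (htan _ _ hn₃0 ?_))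
    · rw [← sub_ne_zero, hn₃n]
      exact mul_ne_zero hrK hnm0
    · intro e
      exact div_ne_zero hε0 hr0 (by linear_combination -e)
    · intro e
      exact div_ne_zero hε0 hp0 (by linear_combination e)
    · intro e
      have h1 : ε / r + ε / p = 0 := by linear_combination e
      field_simp at h1
      rw [hpr] at h1
      exact hε0 (by simpa using h1)
    · simp only [map_neg, map_add, map_div₀, map_zero]
      ring
    · have hE := div_mul_cancel₀ (algebraMap F K ε) hrK
      simp only [map_neg, map_add, map_sub, map_mul, map_div₀, map_zero]
      linear_combination (algebraMap F K (g m) / algebraMap F K θ +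
        algebraMap F K ε / algebraMap F K r) * hn₃n + (n - m) * hE +
        algebraMap F K (g n) / algebraMap F K θ * m * hprK
    · have hE := div_mul_cancel₀ (algebraMap F K ε) hpK
      simp only [map_neg, map_add, map_sub, map_mul, map_div₀]
      linear_combination (algebraMap F K (g m) / algebraMap F K θ -
        algebraMap F K ε / algebraMap F K p) * hn₃m + (n - m) * hE +
        ((algebraMap F K (g n) + algebraMap F K (g m)) / algebraMap F K θ * m -
          algebraMap F K (g m) / algebraMap F K θ * n) * hprK
    · have h1 := hform n m 0 (-(g n / θ)) 1 0
      rw [← hθe, map_one, map_zero, one_mul, zero_mul m, add_zero n] at h1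
      rw [map_zero, h1]
      field_simp
      ring
    · have h1 := hform n m (g m / θ) (-((g n + g m) / θ)) 0 1
      rw [← hθe, map_one, map_zero, one_mul, zero_mul n, zero_add m] at h1
      rw [h1]
      field_simp
      ring
    · rw [hn₃, hform, ← hθe, ← hn₃]
      have h1 : ε * θ = g n₃ := by
        rw [hε]
        field_simp
      field_simp
      linear_combination (r * g m + p * g n + ε * θ) * hpr + hprg + h1
  -- If `n` is dependent on `1`, it lies in `F`, and `β` is independent of both.
  have hall : ∀ n, n ≠ 0 → g n = g 1 := by
    intro n hn
    by_cases hθ : τ (n * conj F 1) = 0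
    · have h1 : g β = g 1 := hind _ _ (by rw [map_one, mul_one, hβ]; exact one_ne_zero)
      rw [← h1]
      obtain ⟨z, hz⟩ := (h.coord _).1 hθ
      rw [map_one, mul_one] at hz
      rw [← hz]
      refine (hind _ _ ?_).symm
      rw [AlgHom.commutes, mul_comm, map_algebraMap_mul, hβ, mul_one]
      rintro rfl
      rw [map_zero] at hz
      exact hn hz.symm
    · exact hind _ _ hθ
  refine ⟨-algebraMap F K (g 1), fun m => ?_⟩
  by_cases hm : m = 0
  · rw [hm, (h.zero 0).2 rfl]
    simp
  · rw [← hall m⁻¹ (inv_ne_zero hm), hg]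
    simp only [inv_inv, map_neg, map_mul, hν, map_inv₀]
    have := mt (conj_eq_zero (F := F)).1 hm
    field_simp

end OvoidQuadrangle

/-! ### The Hermitian curve: no quadrangles, and its Buekenhout-Metz form. -/

section Hermitian

variable {F K : Type*} [Field F] [Field K] [Finite F] [Finite K] [Algebra F K]

variable (F) in
/-- The Hermitian form of the curve `X₀^(q+1) + X₁^(q+1) + X₂^(q+1) = 0`. -/
noncomputable def herm (u v : Fin 3 → K) : K :=
  u 0 * conj F (v 0) + u 1 * conj F (v 1) + u 2 * conj F (v 2)

theorem herm_add_left (u u' v : Fin 3 → K) : herm F (u + u') v = herm F u v + herm F u' v := by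
  simp only [herm, Pi.add_apply]
  ring

theorem herm_smul_left (a : K) (u v : Fin 3 → K) : herm F (a • u) v = a * herm F u v := by
  simp only [herm, Pi.smul_apply, smul_eq_mul]
  ring

theorem herm_add_right (u v v' : Fin 3 → K) : herm F u (v + v') = herm F u v + herm F u v' := by
  simp only [herm, Pi.add_apply, map_add]
  ring

theorem herm_smul_right (a : K) (u v : Fin 3 → K) :
    herm F u (a • v) = conj F a * herm F u v := by
  simp only [herm, Pi.smul_apply, smul_eq_mul, map_mul]
  ring

theorem conj_herm (hFK : Module.finrank F K = 2) (u v : Fin 3 → K) :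
    conj F (herm F u v) = herm F v u := by
  simp only [herm, map_add, map_mul, conj_conj hFK]
  ring

theorem mk_mem_hermitianCurve {w : Fin 3 → K} (hw : w ≠ 0) :
    Projectivization.mk K w hw ∈ hermitianCurve K (Nat.card F) ↔ herm F w w = 0 := by
  have hh : ∀ v : Fin 3 → K, v 0 ^ (Nat.card F + 1) + v 1 ^ (Nat.card F + 1) +
      v 2 ^ (Nat.card F + 1) = herm F v v := fun v => by simp only [pow_card_add_one, herm]
  constructor
  · rintro ⟨v, hv, h, h'⟩
    rw [hh] at h'
    obtain ⟨a, rfl⟩ := (Projectivization.mk_eq_mk_iff' K w v hw hv).1 h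
    rw [herm_smul_left, herm_smul_right, h', mul_zero, mul_zero]
  · intro h
    exact ⟨w, hw, rfl, by rw [hh, h]⟩

theorem exists_eq_sum {u₀ u₁ u₂ : Fin 3 → K} (h : LinearIndependent K ![u₀, u₁, u₂])
    (v : Fin 3 → K) : ∃ x y z : K, v = x • u₀ + y • u₁ + z • u₂ := by
  let b := basisOfLinearIndependentOfCardEqFinrank h (by simp)
  refine ⟨b.repr v 0, b.repr v 1, b.repr v 2, ?_⟩
  conv_lhs => rw [← b.sum_repr v]
  simp [Fin.sum_univ_three, b]

theorem eq_zero_of_herm_eq_zero {u₀ u₁ u₂ v : Fin 3 → K}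
    (h : LinearIndependent K ![u₀, u₁, u₂]) (h₀ : herm F v u₀ = 0) (h₁ : herm F v u₁ = 0)
    (h₂ : herm F v u₂ = 0) : v = 0 := by
  have hall : ∀ w, herm F v w = 0 := by
    intro w
    obtain ⟨x, y, z, rfl⟩ := exists_eq_sum h w
    simp only [herm_add_right, herm_smul_right, h₀, h₁, h₂, mul_zero, add_zero]
  ext i
  have := hall (Pi.single i 1)
  fin_cases i <;> simpa [herm] using this

/-- Three independent vectors cannot be scaled in such a way that all entries of their Gram matrix
are `1`. -/
theorem false_of_gram_eq_one {u₀ u₁ u₂ : Fin 3 → K} (h : LinearIndependent K ![u₀, u₁, u₂])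
    {a₀ a₁ a₂ : K} (h₀₀ : a₀ * conj F a₀ * herm F u₀ u₀ = 1)
    (h₀₁ : a₀ * conj F a₁ * herm F u₀ u₁ = 1) (h₀₂ : a₀ * conj F a₂ * herm F u₀ u₂ = 1)
    (h₁₀ : a₁ * conj F a₀ * herm F u₁ u₀ = 1) (h₁₁ : a₁ * conj F a₁ * herm F u₁ u₁ = 1)
    (h₁₂ : a₁ * conj F a₂ * herm F u₁ u₂ = 1) : False := by
  have ha₀ : a₀ ≠ 0 := by rintro rfl; simp at h₀₀
  -- The first two rows of the Gram matrix agree, so `a₀ u₀ - a₁ u₁` is orthogonal to a basis.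
  have hz : ∀ (u : Fin 3 → K) (a : K), a₀ * conj F a * herm F u₀ u = 1 →
      a₁ * conj F a * herm F u₁ u = 1 → herm F (a₀ • u₀ + (-a₁) • u₁) u = 0 := by
    intro u a h1 h2
    have ha : conj F a ≠ 0 := by intro e; rw [e] at h1; simp at h1
    rw [herm_add_left, herm_smul_left, herm_smul_left]
    apply mul_left_cancel₀ ha
    linear_combination h1 - h2
  have h0 := eq_zero_of_herm_eq_zero h (hz u₀ a₀ h₀₀ h₁₀) (hz u₁ a₁ h₀₁ h₁₁) (hz u₂ a₂ h₀₂ h₁₂)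
  have := Fintype.linearIndependent_iff.1 h ![a₀, -a₁, 0]
    (by simpa [Fin.sum_univ_three] using h0) 0
  exact ha₀ (by simpa using this)

/-- Scale the vectors so that the diagonal and the products with `w₀` are `1`. The remaining
products `a`, `b`, `c` have norm `1`, and each differs from `1`, as otherwise `w₀` and two further
vectors would have an all-ones Gram matrix. The dependence of the four vectors then forces `b = a
c`, and this allows `w₁`, `w₂`, `w₃` to be rescaled to an all-ones Gram matrix. -/
theorem false_of_gram {w₀ w₁ w₂ w₃ : Fin 3 → K} (hFK : Module.finrank F K = 2)
    (l₁ : LinearIndependent K ![w₀, w₁, w₂]) (l₂ : LinearIndependent K ![w₀, w₁, w₃])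
    (l₃ : LinearIndependent K ![w₀, w₂, w₃]) (l₄ : LinearIndependent K ![w₁, w₂, w₃])
    (n₀ : herm F w₀ w₀ ≠ 0) (n₁ : herm F w₁ w₁ ≠ 0) (n₂ : herm F w₂ w₂ ≠ 0)
    (n₃ : herm F w₃ w₃ ≠ 0)
    (h₀₁ : herm F w₀ w₁ * herm F w₁ w₀ = herm F w₀ w₀ * herm F w₁ w₁)
    (h₀₂ : herm F w₀ w₂ * herm F w₂ w₀ = herm F w₀ w₀ * herm F w₂ w₂)
    (h₀₃ : herm F w₀ w₃ * herm F w₃ w₀ = herm F w₀ w₀ * herm F w₃ w₃)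
    (h₁₂ : herm F w₁ w₂ * herm F w₂ w₁ = herm F w₁ w₁ * herm F w₂ w₂)
    (h₁₃ : herm F w₁ w₃ * herm F w₃ w₁ = herm F w₁ w₁ * herm F w₃ w₃)
    (h₂₃ : herm F w₂ w₃ * herm F w₃ w₂ = herm F w₂ w₂ * herm F w₃ w₃) : False := by
  obtain ⟨f, hf⟩ := conj_eq_self_iff.1 (conj_herm hFK w₀ w₀)
  have hf0 : f ≠ 0 := by
    rintro rfl
    rw [map_zero] at hf
    exact n₀ hf.symm
  obtain ⟨s₀, hs₀⟩ := exists_mul_conj_eq hFK (inv_ne_zero hf0)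
  have d₀ : s₀ * conj F s₀ * herm F w₀ w₀ = 1 := by
    rw [hs₀, ← hf, ← map_mul, inv_mul_cancel₀ hf0, map_one]
  have hs₀0 : s₀ ≠ 0 := by rintro rfl; simp at d₀
  have hs₀c : conj F s₀ ≠ 0 := mt conj_eq_zero.1 hs₀0
  -- The scalar is fixed by its product with `w₀`; the vanishing Gram determinant makes the diagonal
  -- entry come out as `1`.
  have hscale : ∀ w : Fin 3 → K, herm F w w ≠ 0 →
      herm F w₀ w * herm F w w₀ = herm F w₀ w₀ * herm F w w →
      ∃ s, s * conj F s * herm F w w = 1 ∧ s₀ * conj F s * herm F w₀ w = 1 ∧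
        s * conj F s₀ * herm F w w₀ = 1 := by
    intro w hw h
    have h1 : herm F w₀ w ≠ 0 := left_ne_zero_of_mul (h ▸ mul_ne_zero n₀ hw)
    have h2 : herm F w w₀ ≠ 0 := right_ne_zero_of_mul (h ▸ mul_ne_zero n₀ hw)
    have hc : conj F (conj F s₀ * herm F w w₀)⁻¹ = (s₀ * herm F w₀ w)⁻¹ := by
      rw [map_inv₀, map_mul, conj_conj hFK, conj_herm hFK]
    refine ⟨(conj F s₀ * herm F w w₀)⁻¹, ?_, ?_, ?_⟩
    · rw [hc]
      field_simp
      linear_combination (-herm F w w) * d₀ - (s₀ * conj F s₀) * h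
    · rw [hc]
      field_simp
    · field_simp
  obtain ⟨s₁, d₁, e₀₁, e₁₀⟩ := hscale w₁ n₁ h₀₁
  obtain ⟨s₂, d₂, e₀₂, e₂₀⟩ := hscale w₂ n₂ h₀₂
  obtain ⟨s₃, d₃, e₀₃, e₃₀⟩ := hscale w₃ n₃ h₀₃
  have hinv : ∀ (s t : K) (u v : Fin 3 → K), s * conj F s * herm F u u = 1 →
      t * conj F t * herm F v v = 1 → herm F u v * herm F v u = herm F u u * herm F v v →
      (s * conj F t * herm F u v) * (t * conj F s * herm F v u) = 1 := by
    intro s t u v h1 h2 h3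
    linear_combination (s * conj F t * t * conj F s) * h3 + t * conj F t * herm F v v * h1 + h2
  have hconj : ∀ (s t : K) (u v : Fin 3 → K),
      conj F (s * conj F t * herm F u v) = t * conj F s * herm F v u := by
    intro s t u v
    rw [map_mul, map_mul, conj_conj hFK, conj_herm hFK]
    ring
  obtain ⟨a, ha⟩ : ∃ a, a = s₁ * conj F s₂ * herm F w₁ w₂ := ⟨_, rfl⟩
  obtain ⟨b, hb⟩ : ∃ b, b = s₁ * conj F s₃ * herm F w₁ w₃ := ⟨_, rfl⟩
  obtain ⟨c, hc⟩ : ∃ c, c = s₂ * conj F s₃ * herm F w₂ w₃ := ⟨_, rfl⟩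
  have ha' : conj F a = s₂ * conj F s₁ * herm F w₂ w₁ := by rw [ha, hconj]
  have hb' : conj F b = s₃ * conj F s₁ * herm F w₃ w₁ := by rw [hb, hconj]
  have hc' : conj F c = s₃ * conj F s₂ * herm F w₃ w₂ := by rw [hc, hconj]
  have haa : a * conj F a = 1 := by rw [ha', ha, hinv _ _ _ _ d₁ d₂ h₁₂]
  have hbb : b * conj F b = 1 := by rw [hb', hb, hinv _ _ _ _ d₁ d₃ h₁₃]
  have hcc : c * conj F c = 1 := by rw [hc', hc, hinv _ _ _ _ d₂ d₃ h₂₃]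
  have ha1 : a - 1 ≠ 0 := by
    rw [sub_ne_zero]
    intro e
    exact false_of_gram_eq_one l₁ d₀ e₀₁ e₀₂ e₁₀ d₁ (by rw [← ha, e])
  have hb1 : b - 1 ≠ 0 := by
    rw [sub_ne_zero]
    intro e
    exact false_of_gram_eq_one l₂ d₀ e₀₁ e₀₃ e₁₀ d₁ (by rw [← hb, e])
  have hc1 : c - 1 ≠ 0 := by
    rw [sub_ne_zero]
    intro e
    exact false_of_gram_eq_one l₃ d₀ e₀₂ e₀₃ e₂₀ d₂ (by rw [← hc, e])
  have hs : ∀ (s : K) (u : Fin 3 → K), s * conj F s * herm F u u = 1 → s ≠ 0 := by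
    rintro s u h rfl
    simp at h
  obtain ⟨x, y, z, hxyz⟩ : ∃ x y z : K,
      s₃ • w₃ = (x * s₀) • w₀ + (y * s₁) • w₁ + (z * s₂) • w₂ := by
    obtain ⟨x, y, z, h⟩ := exists_eq_sum l₁ (s₃ • w₃)
    refine ⟨x / s₀, y / s₁, z / s₂, ?_⟩
    rw [div_mul_cancel₀ _ hs₀0, div_mul_cancel₀ _ (hs _ _ d₁), div_mul_cancel₀ _ (hs _ _ d₂)]
    exact h
  have hrel : ∀ (s : K) (u : Fin 3 → K), s₃ * conj F s * herm F w₃ u =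
      x * (s₀ * conj F s * herm F w₀ u) + y * (s₁ * conj F s * herm F w₁ u) +
        z * (s₂ * conj F s * herm F w₂ u) := by
    intro s u
    have h := congrArg (fun v => conj F s * herm F v u) hxyz
    simp only [herm_add_left, herm_smul_left] at h
    linear_combination h
  have r₀ := hrel s₀ w₀
  have r₁ := hrel s₁ w₁
  have r₂ := hrel s₂ w₂
  have r₃ := hrel s₃ w₃
  rw [e₃₀, d₀, e₁₀, e₂₀] at r₀
  rw [← hb', e₀₁, d₁, ← ha'] at r₁
  rw [← hc', e₀₂, ← ha, d₂] at r₂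
  rw [d₃, e₀₃, ← hb, ← hc] at r₃
  -- The relations `r₀`, ..., `r₃` pair the expression of `w₃` with the four vectors. Eliminating
  -- the coefficients leaves `(c - 1)(b - 1)(a c - b) = 0`.
  have hbac : b = a * c := by
    have p₁ : a * (1 - b) = z * b * (1 - a) := by
      linear_combination a * b * (r₁ - r₀) - a * hbb + z * b * haa
    have p₂ : 1 - c = y * c * (a - 1) := by
      linear_combination c * (r₂ - r₀) - hcc
    have p₃ : y * (b - 1) + z * (c - 1) = 0 := by linear_combination r₀ - r₃
    have p₄ : (c - 1) * (b - 1) * (a * c - b) = 0 := by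
      linear_combination c * b * (a - 1) * p₃ + b * (b - 1) * p₂ - c * (c - 1) * p₁
    exact (sub_eq_zero.1 ((mul_eq_zero.1 p₄).resolve_left (mul_ne_zero hc1 hb1))).symm
  refine false_of_gram_eq_one l₄ (a₀ := s₁) (a₁ := a * s₂) (a₂ := b * s₃) d₁ ?_ ?_ ?_ ?_ ?_
  · rw [map_mul]
    linear_combination haa - conj F a * ha
  · rw [map_mul]
    linear_combination hbb - conj F b * hb
  · linear_combination haa - a * ha'
  · rw [map_mul]
    linear_combination a * conj F a * d₂ + haa
  · rw [map_mul]
    linear_combination hbb - a * conj F b * hc - conj F b * hbac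

theorem linearIndependent_of_not_mem_line {a b c v : Fin 3 → K} (ha : a ≠ 0) (hb : b ≠ 0)
    (hab : Projectivization.mk K a ha ≠ Projectivization.mk K b hb) (hav : v ⬝ᵥ a = 0)
    (hbv : v ⬝ᵥ b = 0) (hcv : v ⬝ᵥ c ≠ 0) : LinearIndependent K ![a, b, c] := by
  have hli : LinearIndependent K ![a, b] := by
    rw [← crossProduct_ne_zero_iff_linearIndependent]
    exact mt (Projectivization.mk_eq_mk_iff_crossProduct_eq_zero ha hb).2 hab
  rw [LinearIndependent.pair_iff] at hli
  rw [Fintype.linearIndependent_iff]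
  intro g hg
  simp only [Fin.sum_univ_three, Matrix.cons_val_zero, Matrix.cons_val_one, Matrix.cons_val] at hg
  have h := congrArg (fun w => v ⬝ᵥ w) hg
  simp only [dotProduct_add, dotProduct_smul, hav, hbv, dotProduct_zero,
    smul_eq_mul, mul_zero, zero_add] at h
  have h2 : g 2 = 0 := (mul_eq_zero.1 h).resolve_right hcv
  rw [h2, zero_smul, add_zero] at hg
  obtain ⟨h0, h1⟩ := hli _ _ hg
  intro i
  fin_cases i
  exacts [h0, h1, h2]

/-- If the Gram determinant `e` is nonzero, orthogonalise `b` against `a` to get `b'`. The points `t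
a + b'` with `N(t) = -e` are `q + 1` different points of the curve on the line, which is then not
tangent. -/
theorem gram_eq_zero_of_tangent (hFK : Module.finrank F K = 2) {a b v : Fin 3 → K}
    (ha : herm F a a ≠ 0) (hav : v ⬝ᵥ a = 0) (hbv : v ⬝ᵥ b = 0)
    (hv : (hermitianCurve K (Nat.card F) ∩ line v).ncard = 1) :
    herm F a b * herm F b a = herm F a a * herm F b b := by
  by_contra hne
  obtain ⟨e, he⟩ : ∃ e, e = herm F a a * herm F b b - herm F a b * herm F b a := ⟨_, rfl⟩
  have he0 : e ≠ 0 := he ▸ sub_ne_zero.2 (Ne.symm hne)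
  obtain ⟨c, hc⟩ := conj_eq_self_iff.1 (show conj F (-e) = -e by
    rw [he, map_neg, map_sub, map_mul, map_mul, conj_herm hFK, conj_herm hFK, conj_herm hFK,
      conj_herm hFK, mul_comm (herm F b a)])
  have hc0 : c ≠ 0 := by
    rintro rfl
    rw [map_zero] at hc
    exact he0 (neg_eq_zero.1 hc.symm)
  obtain ⟨b', hb'⟩ : ∃ b', b' = herm F a a • b + (-herm F b a) • a := ⟨_, rfl⟩
  have hba : herm F b' a = 0 := by
    rw [hb', herm_add_left, herm_smul_left, herm_smul_left]
    ring
  have hab : herm F a b' = 0 := by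
    rw [← conj_herm hFK, hba, map_zero]
  have hbb : herm F b' b' = herm F a a * e := by
    conv_lhs => rw [hb', herm_add_left, herm_smul_left, herm_smul_left, ← hb', hab]
    rw [hb', herm_add_right, herm_smul_right, herm_smul_right, map_neg, conj_herm hFK,
      conj_herm hFK, he]
    ring
  have hform : ∀ t : K, herm F (t • a + b') b' = herm F a a * e := by
    intro t
    rw [herm_add_left, herm_smul_left, hab, hbb]
    ring
  have hne0 : ∀ t : K, t • a + b' ≠ 0 := by
    intro t h
    have := hform t
    rw [h] at this
    simp only [herm, Pi.zero_apply, zero_mul, add_zero] at this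
    exact mul_ne_zero ha he0 this.symm
  have hforma : ∀ t : K, herm F (t • a + b') a = t * herm F a a := by
    intro t
    rw [herm_add_left, herm_smul_left, hba, add_zero]
  obtain ⟨R, hR⟩ := Set.ncard_eq_one.1 hv
  have hpt : ∀ t : K, t * conj F t = algebraMap F K c →
      Projectivization.mk K (t • a + b') (hne0 t) = R := by
    intro t ht
    refine hR.subset ⟨(mk_mem_hermitianCurve _).2 ?_, (mk_mem_line _).2 ?_⟩
    · rw [herm_add_right, herm_smul_right, hform, hforma]
      linear_combination herm F a a * ht + herm F a a * hc
    · rw [hb']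
      simp [dotProduct_add, dotProduct_smul, hav, hbv]
  have hcard := ncard_mul_conj_eq (K := K) hFK hc0
  have hsub : {x : K | x * conj F x = algebraMap F K c}.Subsingleton := by
    intro t ht t' ht'
    have h := (hpt t ht).trans (hpt t' ht').symm
    obtain ⟨d, hd⟩ := (Projectivization.mk_eq_mk_iff' K _ _ _ _).1 h
    have h1 := congrArg (fun w => herm F w b') hd
    have h2 := congrArg (fun w => herm F w a) hd
    simp only [herm_smul_left, hform, hforma] at h1 h2
    have hd1 : d = 1 := mul_right_cancel₀ (mul_ne_zero ha he0) (h1.trans (one_mul _).symm)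
    rw [hd1, one_mul] at h2
    exact (mul_right_cancel₀ ha h2).symm
  have h1 := Set.ncard_le_one_iff_subsingleton.2 hsub
  have h2 := Finite.card_pos (α := F)
  omega

theorem not_isQuadrangle_hermitianCurve (hFK : Module.finrank F K = 2)
    (P Q R S : {P : Plane K // P ∉ hermitianCurve K (Nat.card F)}) :
    ¬ IsQuadrangle (tangentInc (hermitianCurve K (Nat.card F))) P Q R S := by
  intro h
  have hn : ∀ P : {P : Plane K // P ∉ hermitianCurve K (Nat.card F)},
      herm F P.1.rep P.1.rep ≠ 0 := by
    intro P e
    apply P.2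
    rw [← P.1.mk_rep, mk_mem_hermitianCurve]
    exact e
  have hg : ∀ P Q, (blockGraph (tangentInc (hermitianCurve K (Nat.card F)))).Adj P Q →
      herm F P.1.rep Q.1.rep * herm F Q.1.rep P.1.rep =
        herm F P.1.rep P.1.rep * herm F Q.1.rep Q.1.rep := by
    rintro P Q ⟨-, t, hP, hQ⟩
    exact gram_eq_zero_of_tangent hFK (hn P) hP hQ t.2
  have hl : ∀ P Q R, (blockGraph (tangentInc (hermitianCurve K (Nat.card F)))).Adj P Q →
      (∀ t, tangentInc (hermitianCurve K (Nat.card F)) P t →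
        tangentInc (hermitianCurve K (Nat.card F)) Q t →
        ¬ tangentInc (hermitianCurve K (Nat.card F)) R t) →
      LinearIndependent K ![P.1.rep, Q.1.rep, R.1.rep] := by
    rintro P Q R ⟨hne, t, hP, hQ⟩ hR
    refine linearIndependent_of_not_mem_line P.1.rep_nonzero Q.1.rep_nonzero ?_ hP hQ (hR t hP hQ)
    rw [P.1.mk_rep, Q.1.mk_rep]
    exact fun e => hne (Subtype.ext e)
  exact false_of_gram hFK (hl _ _ _ h.vw h.vwx) (hl _ _ _ h.vw h.vwy) (hl _ _ _ h.vx h.vxy)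
    (hl _ _ _ h.wx h.wxy) (hn _) (hn _) (hn _) (hn _) (hg _ _ h.vw) (hg _ _ h.vx) (hg _ _ h.vy)
    (hg _ _ h.wx) (hg _ _ h.wy) (hg _ _ h.xy)

theorem mk_mem_bmSet_zero (hFK : Module.finrank F K = 2) {β : K}
    (hβ : β ∉ Set.range (algebraMap F K)) {w : Fin 3 → K} (hw : w ≠ 0) :
    Projectivization.mk K w hw ∈ bmSet F 0 β ↔
      (β - conj F β) * (w 0 * conj F (w 0)) = w 1 * conj F (w 2) - conj F (w 1) * w 2 := by
  obtain ⟨τ, hτ, -⟩ := exists_coord hFK hβ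
  rw [bmSet_eq_ovoidSet hτ]
  have hγ : β - conj F β ≠ 0 := sub_ne_zero.2 fun h => hβ (conj_eq_self_iff.1 h.symm)
  by_cases h2 : w 2 = 0
  · rw [h2, map_zero, mul_zero, mul_zero, sub_zero]
    have hiff : (β - conj F β) * (w 0 * conj F (w 0)) = 0 ↔ w 0 = 0 := by
      rw [mul_eq_zero, mul_eq_zero, conj_eq_zero, or_self]
      exact or_iff_right hγ
    rw [hiff]
    constructor
    · rintro (⟨x, y, h, -⟩ | h)
      · have h1 : affinePoint x y ∈ line (![0, 0, 1] : Fin 3 → K) := by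
          rw [← h, mk_mem_line]
          simpa [dotProduct, Fin.sum_univ_three] using h2
        rw [affinePoint_mem_line] at h1
        simp at h1
      · have h1 : infinitePoint K ∈ line (![1, 0, 0] : Fin 3 → K) := by
          rw [infinitePoint_mem_line]
          simp
        rw [← Set.mem_singleton_iff.1 h, mk_mem_line] at h1
        simpa [dotProduct, Fin.sum_univ_three] using h1
    · intro h0
      right
      rw [Set.mem_singleton_iff, infinitePoint, Projectivization.mk_eq_mk_iff']
      refine ⟨w 1, ?_⟩
      ext i
      fin_cases i <;> simp [h0, h2]
  · have h2' : conj F (w 2) ≠ 0 := mt conj_eq_zero.1 h2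
    have hP : Projectivization.mk K w hw = affinePoint (w 0 / w 2) (w 1 / w 2) := by
      rw [affinePoint, Projectivization.mk_eq_mk_iff']
      refine ⟨w 2, ?_⟩
      ext i
      fin_cases i <;> simp [mul_div_cancel₀, h2]
    rw [hP, affinePoint_mem_ovoidSet, ← sub_eq_zero, ← map_sub, hτ, ← conj_eq_self_iff]
    simp only [map_sub, map_mul, map_div₀, conj_conj hFK, zero_mul, zero_add]
    rw [← sub_eq_zero, ← sub_eq_zero (b := w 1 * conj F (w 2) - conj F (w 1) * w 2)]
    have key : (conj F (w 1) / conj F (w 2) - conj F β * (conj F (w 0) / conj F (w 2) *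
        (w 0 / w 2)) - (w 1 / w 2 - β * (w 0 / w 2 * (conj F (w 0) / conj F (w 2))))) *
        (w 2 * conj F (w 2)) =
        (β - conj F β) * (w 0 * conj F (w 0)) - (w 1 * conj F (w 2) - conj F (w 1) * w 2) := by
      field_simp
      ring
    rw [← key, mul_eq_zero, or_iff_left (mul_ne_zero h2 h2')]

/-- The Hermitian curve in the form of a Buekenhout-Metz unital. -/
theorem projEquivalent_hermitianCurve (hFK : Module.finrank F K = 2) {β : K}
    (hβ : β ∉ Set.range (algebraMap F K)) :
    ProjEquivalent (hermitianCurve K (Nat.card F)) (bmSet F 0 β) := by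
  obtain ⟨γ, hγe⟩ : ∃ γ, γ = β - conj F β := ⟨_, rfl⟩
  have hγ : γ ≠ 0 := hγe ▸ sub_ne_zero.2 fun h => hβ (conj_eq_self_iff.1 h.symm)
  have hγc : conj F γ = -γ := by
    rw [hγe, map_sub, conj_conj hFK]
    ring
  obtain ⟨μ, hμ⟩ := exists_mul_conj_eq (K := K) hFK (c := (-1 : F)) (by simp)
  rw [map_neg, map_one] at hμ
  have hμ0 : μ ≠ 0 := by rintro rfl; simp at hμ
  -- Since `γ ^ 2` is fixed by conjugation, `b - conj F b = γ⁻¹`. Together with `N(μ) = -1`, this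
  -- makes the last two terms of the Hermitian form a difference of norms equal to `-γ⁻¹` times the
  -- alternating part of the equation of `bmSet F 0 β`.
  obtain ⟨b, hb⟩ : ∃ b, b = β / γ ^ 2 := ⟨_, rfl⟩
  have hbb : (b - conj F b) * γ = 1 := by
    rw [hb, map_div₀, map_pow, hγc, neg_sq, ← sub_div, ← hγe]
    field_simp
  have hb0 : b - conj F b ≠ 0 := left_ne_zero_of_mul (hbb ▸ one_ne_zero)
  let f : (Fin 3 → K) →ₗ[K] (Fin 3 → K) :=
    { toFun := fun w => ![w 0, w 1 + b * w 2, μ * (w 1 + conj F b * w 2)]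
      map_add' := by
        intro u v
        ext i
        fin_cases i <;> simp <;> ring
      map_smul' := by
        intro a u
        ext i
        fin_cases i <;> simp <;> ring }
  have hfi : Function.Injective f := by
    rw [← LinearMap.ker_eq_bot, LinearMap.ker_eq_bot']
    intro w hw
    have h0 : w 0 = 0 := congrFun hw 0
    have h1 : w 1 + b * w 2 = 0 := congrFun hw 1
    have h2 : μ * (w 1 + conj F b * w 2) = 0 := congrFun hw 2
    have h3 := (mul_eq_zero.1 h2).resolve_left hμ0
    have h4 : (b - conj F b) * w 2 = 0 := by linear_combination h1 - h3
    have h5 := (mul_eq_zero.1 h4).resolve_left hb0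
    rw [h5, mul_zero, add_zero] at h1
    ext i
    fin_cases i
    exacts [h0, h1, h5]
  refine ⟨LinearEquiv.ofInjectiveEndo f hfi, ?_⟩
  have hbij := map_bijective (LinearEquiv.ofInjectiveEndo f hfi)
  ext P
  obtain ⟨Q, rfl⟩ := hbij.2 P
  rw [hbij.1.mem_set_image]
  induction Q using Projectivization.ind with
  | h w hw =>
    rw [Projectivization.map_mk, mk_mem_hermitianCurve, mk_mem_bmSet_zero hFK hβ, ← hγe]
    have key : γ * herm F (f w) (f w) = γ * (w 0 * conj F (w 0)) -
        (w 1 * conj F (w 2) - conj F (w 1) * w 2) := by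
      change γ * (w 0 * conj F (w 0) + (w 1 + b * w 2) * conj F (w 1 + b * w 2) +
        μ * (w 1 + conj F b * w 2) * conj F (μ * (w 1 + conj F b * w 2))) = _
      simp only [map_add, map_mul, conj_conj hFK]
      linear_combination γ * (w 1 + conj F b * w 2) * (conj F (w 1) + b * conj F (w 2)) * hμ -
        (w 1 * conj F (w 2) - conj F (w 1) * w 2) * hbb
    have hfe : herm F (LinearEquiv.ofInjectiveEndo f hfi w)
        (LinearEquiv.ofInjectiveEndo f hfi w) = herm F (f w) (f w) := rfl
    rw [← sub_eq_zero, ← key, mul_eq_zero, or_iff_right hγ]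
    exact Iff.rfl

theorem isUnital_hermitianCurve (hFK : Module.finrank F K = 2) :
    IsUnital (Nat.card F) (hermitianCurve K (Nat.card F)) := by
  obtain ⟨β, hβ⟩ := exists_not_mem_range hFK
  obtain ⟨τ, hτ, hτβ, -⟩ := exists_coord hFK hβ
  refine IsUnital.of_projEquivalent ?_ (projEquivalent_hermitianCurve hFK hβ)
  rw [bmSet_eq_ovoidSet hτ]
  obtain ⟨G, hG⟩ := bm_norm_ovoidData hτ hFK hτβ
  exact hG.isUnital hFK hτβ

end Hermitian

/-! ### Both families of Buekenhout unitals, and the theorem. -/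

section Main

variable {F K : Type*} [Field F] [Field K] [Finite F] [Finite K] [Algebra F K]

/-- A Buekenhout unital is ovoidal, and it is classical if its dual function is a multiple of
the norm. -/
theorem IsBuekenhout.exists_ovoidData (hFK : Module.finrank F K = 2) {U : Set (Plane K)}
    (hU : IsBuekenhout F U) : ∃ (τ : K →ₗ[F] F) (β : K) (φ G : K → F), τ β = 1 ∧
      OvoidData τ φ G ∧ ProjEquivalent U (ovoidSet τ φ) ∧
      ((∃ k : K, ∀ m, algebraMap F K (G m) = k * (m * conj F m)) →
        IsClassical (Nat.card F) U) := by
  rcases hU with ⟨hq, α, β, hc, hU⟩ | ⟨m, hm1, hm, hcard, β, hβ, hU⟩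
  · obtain ⟨β₀, hβ₀⟩ := exists_not_mem_range hFK
    obtain ⟨τ, hτ, hτβ, -⟩ := exists_coord hFK hβ₀
    obtain ⟨G, hG, hG'⟩ := bm_ovoidData hτ hFK hc.bmDisc_ne_zero (hc.anisotropic hFK hτ)
    refine ⟨τ, β₀, _, G, hτβ, hG, bmSet_eq_ovoidSet hτ α β ▸ hU, ?_⟩
    rintro ⟨k, hk⟩
    have hα := bm_eq_zero_of_dual_eq_norm hFK hq hτ hτβ hc.bmDisc_ne_zero hG' hk
    have hD := hc.bmDisc_ne_zero
    rw [hα] at hU hD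
    refine hU.trans (projEquivalent_hermitianCurve hFK fun hβ => hD ?_).symm
    rw [bmDisc, conj_eq_self_iff.2 hβ]
    ring
  · have he : Even (Nat.card F) := by
      rw [hcard]
      exact even_two.pow_of_ne_zero (by omega)
    have h2 := two_eq_zero_of_even_card he
    have hchar : CharP F 2 := CharTwo.of_one_ne_zero_of_two_eq_zero one_ne_zero h2
    have := Fintype.ofFinite F
    have hpow : ∀ x : F, x ^ 2 ^ m = x := by
      intro x
      rw [← hcard, Nat.card_eq_fintype_card, FiniteField.pow_card]
    obtain ⟨τ, hτ, hτβ, hrep⟩ := exists_coord hFK hβ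
    have hq : 2 < Nat.card F := by
      rw [hcard]
      exact lt_of_lt_of_le (by norm_num) (Nat.pow_le_pow_right two_pos hm1)
    -- The Tits automorphism is `x ↦ x ^ 2 ^ ((m + 1) / 2)`; for odd `m` its square is `x ↦ x ^ 2 ^
    -- (m + 1)`, which is squaring on `F`.
    obtain ⟨φ, G, hG, hφ, hk⟩ := tits_ovoidData (s := iterateFrobenius F 2 ((m + 1) / 2)) hFK hq
      (fun x => by
        obtain ⟨n, rfl⟩ := hm
        rw [iterateFrobenius_def, iterateFrobenius_def, ← pow_mul, ← pow_add,
          show (2 * n + 1 + 1) / 2 + (2 * n + 1 + 1) / 2 = (2 * n + 1) + 1 by omega, pow_succ,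
          pow_mul, hpow]) h2 hτ hτβ hrep
    refine ⟨τ, β, φ, G, hτβ, hG, ?_, ?_⟩
    · rw [← btSet_eq_ovoidSet hτ hτβ hrep (δ := 2 ^ ((m + 1) / 2))]
      · exact hU
      · intro x y
        rw [hφ, iterateFrobenius_def, iterateFrobenius_def, pow_add]
    · rintro ⟨k, hk'⟩
      obtain ⟨m, hm⟩ := hk k
      exact absurd (hk' m) hm

end Main

end TangentGraph

theorem mainTheorem3 {F K : Type*} [Field F] [Field K] [Finite F] [Finite K] [Algebra F K]
    (hFK : Module.finrank F K = 2) (q : ℕ) (hF : Nat.card F = q) (hq : 2 < q)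
    (U : Set (TangentGraph.Plane K)) (hU : TangentGraph.IsBuekenhout F U)
    (hUnc : ¬ TangentGraph.IsClassical q U) :
    TangentGraph.IsSRG (TangentGraph.tangentGraph U)
      (q ^ 2 * (q ^ 2 - q + 1)) ((q + 1) * (q ^ 2 - 1)) (2 * (q ^ 2 - 1)) ((q + 1) ^ 2) ∧
    TangentGraph.IsSRG (TangentGraph.NU3 K q)
      (q ^ 2 * (q ^ 2 - q + 1)) ((q + 1) * (q ^ 2 - 1)) (2 * (q ^ 2 - 1)) ((q + 1) ^ 2) ∧
    IsEmpty (TangentGraph.tangentGraph U ≃g TangentGraph.NU3 K q) := by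
  open TangentGraph in
  subst hF
  have hq0 : 0 < Nat.card F := by omega
  have hK := natCard_eq_sq hFK
  obtain ⟨τ, β, φ, G, hβ, hG, hUφ, hcl⟩ := hU.exists_ovoidData hFK
  have hO := hG.isUnital hFK hβ
  have hH := isUnital_hermitianCurve (F := F) (K := K) hFK
  refine ⟨(hO.of_projEquivalent hUφ).isSRG hq0 hK, hH.isSRG hq0 hK, ⟨fun e => ?_⟩⟩
  obtain ⟨e'⟩ := hUφ.nonempty_iso
  have e'' : tangentGraph (ovoidSet τ φ) ≃g tangentGraph (hermitianCurve K (Nat.card F)) :=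
    e'.trans e
  rw [tangentGraph_eq_blockGraph, tangentGraph_eq_blockGraph] at e''
  have := Fintype.ofFinite {P : Plane K // P ∉ ovoidSet τ φ}
  have := Fintype.ofFinite {P : Plane K // P ∉ hermitianCurve K (Nat.card F)}
  have := Fintype.ofFinite (TangentLine (ovoidSet τ φ))
  have := Fintype.ofFinite (TangentLine (hermitianCurve K (Nat.card F)))
  refine ((hO.isDesign hq0 hK).isEmpty_iso (hH.isDesign hq0 hK) ?_
    (not_isQuadrangle_hermitianCurve hFK)).false e''
  -- Without a quadrangle the dual function would be a multiple of the norm, and `U` would be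
  -- classical.
  by_contra hno
  exact hUnc (hcl (hG.eq_norm_of_forall_not_isQuadrangle hFK hβ hno))
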